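/- Let $N\ge 1$, $n\ge 0$, $V=\mathbb C^N$ with matrix units $E_{ab}$, and let $e_{ab}$ be the standard generators of $\mathfrak{gl}_N$, $[e_{ab},e_{cd}]=\delta_{bc}e_{ad}-\delta_{ad}e_{cb}$. Let $M_1,\dots,M_n$ be arbitrary $\mathfrak{gl}_N$-modules over $\mathbb C$, $z_1,\dots,z_n\in\mathbb C$, and let $K=\sum_a K_aE_{aa}$ be a diagonal matrix with pairwise distinct $K_1,\dots,K_N\in\mathbb C$. On $M=M_1\otimes\cdots\otimes M_n$ write $e_{ab}^{(i)}$ for $e_{ab}$ acting in the $i$-th factor and $e_{ab}=\sum_i e_{ab}^{(i)}$. Let $A_k$ be the skew-symmetrization projector in $V^{\otimes k}$, with image $\Lambda^kV$. The superscript $(i)$ on an element of $\mathrm{End}(V)\otimes\mathcal A$ means that its matrix factor acts in the $i$-th copy of $V$ in $V^{\otimes k}$. Gaudin transfer matrices: in $U(\mathfrak{gl}_N[x])[[u^{-1}]]$ put $L_{ab}(u)=\sum_{s\ge0}(e_{ba}x^s)u^{-s-1}$, $L(u)=\sum_{a,b}E_{ab}\otimes L_{ab}(u)$, and define $\mathcal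 G_{k,K}(u)$, $0\le k\le N$, by $$(\mathrm{tr}_{V^{\otimes N}}\otimes\mathrm{id})\bigl((\partial_u-K^{(1)}-L^{(1)}(u))\cdots(\partial_u-K^{(N)}-L^{(N)}(u))A_N\bigr)=\sum_{k=0}^N(-1)^k\mathcal G_{k,K}(u)\,\partial_u^{N-k}.$$ Let $\mathcal G_{k,K}(u;z)$ be the action of $\mathcal G_{k,K}(u)$ on the tensor product of evaluation modules, where $e_{ab}x^s$ acts as $\sum_i z_i^s e_{ab}^{(i)}$. XXX transfer matrices: the Yangian $Y(\mathfrak{gl}_N)$ has generators $T_{ab}^{\{s\}}$, $s\ge1$, and, with $T_{ab}(u)=\delta_{ab}+\sum_{s\ge1}T_{ab}^{\{s\}}u^{-s}$, relations $(u-v)[T_{ab}(u),T_{cd}(v)]=T_{cb}(v)T_{ad}(u)-T_{cb}(u)T_{ad}(v)$ and coproduct $\Delta T_{ab}(u)=\sum_cT_{cb}(u)\otimes T_{ac}(u)$. Put $T(u)=\sum_{a,b}E_{ab}\otimes T_{ab}(u)$ and $$\mathcal T_{k,K}(u)=(\mathrm{tr}_{\Lambda^kV}\otimes\mathrm{id})\bigl(K^{\otimes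 k}\,T^{(k)}(u)T^{(k-1)}(u-1)\cdots T^{(1)}(u-k+1)\big|_{\Lambda^kV}\bigr),\qquad \mathcal T_{0,K}(u)=1.$$ Let $\mathcal T_{k,K}(u;z)$ be the action of $\mathcal T_{k,K}(u)$ on $M_1(z_1)\otimes\cdots\otimes M_n(z_n)$, where on $M_i(z_i)$ the series $T_{ab}(u)$ acts as $\delta_{ab}+e_{ba}(u-z_i)^{-1}$. The dynamical Hamiltonians are $$G_{a,K}(z)=\sum_i z_ie_{aa}^{(i)}+\sum_{b\ne a}\frac{e_{ab}e_{ba}-e_{aa}}{K_a-K_b},$$ $$X_{a,K}(z)=-\frac{(e_{aa})^2}{2}+\sum_i z_ie_{aa}^{(i)}+\sum_{b=1}^N\sum_{i<j}e_{ab}^{(i)}e_{ba}^{(j)}+\sum_{b\ne a}\frac{K_b}{K_a-K_b}(e_{ab}e_{ba}-e_{aa}).$$ Then, for every $x\in\mathbb C\setminus\{K_1,\dots,K_N\}$, the following hold as expansions in powers of $u^{-1}$ with coefficients in $\mathrm{End}(M)$: $$\sum_{k=0}^N(-1)^k\mathcal G_{k,K}(u;z)\,x^{N-k}\prod_{a=1}^N\frac1{x-K_a}=1-u^{-1}\sum_{a}\frac{e_{aa}}{x-K_a}-u^{-2}\sum_{a}\frac1{x-K_a}\Bigl(G_{a,K}(z)-\sum_{b\ne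 a}\frac{e_{aa}e_{bb}}{K_a-K_b}\Bigr)+O(u^{-3}),$$ $$\sum_{k=0}^N(-1)^k\mathcal T_{k,K}(u;z)\,x^{N-k}\prod_{a=1}^N\frac1{x-K_a}=1-u^{-1}\sum_{a}\frac{K_a}{x-K_a}e_{aa}-u^{-2}\sum_{a}\frac{K_a}{x-K_a}\Bigl(X_{a,K}(z)+\frac{(e_{aa})^2}{2}-\sum_{b\ne a}\frac{K_b}{K_a-K_b}e_{aa}e_{bb}\Bigr)+O(u^{-3}).$$ -/

import Mathlib

open scoped TensorProduct

attribute [local instance] LieRing.ofAssociativeRing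

noncomputable section

namespace DynHam

/-! ## Formal series in `u⁻¹`

A series `∑ₛ fₛ u⁻ˢ` with coefficients in a ring `A` is an element of `PowerSeries A`; the variable
`PowerSeries.X` stands for `u⁻¹`. -/

section Series

/-- The derivative `d/du` of a series in `u⁻¹`: `u⁻ᵐ ↦ -m u⁻ᵐ⁻¹`. -/
def derivU {A : Type*} [Ring A] (f : PowerSeries A) : PowerSeries A :=
  PowerSeries.mk fun m =>
    match m with
    | 0 => 0
    | m + 1 => -(m • PowerSeries.coeff m f)

/-- The expansion `(u - c)⁻¹ = ∑ⱼ cʲ u⁻ʲ⁻¹`. -/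
def invShift (c : ℂ) : PowerSeries ℂ :=
  PowerSeries.X * PowerSeries.mk fun j => c ^ j

/-- The series `f(u - c) = ∑ₛ fₛ (u - c)⁻ˢ`, re-expanded in powers of `u⁻¹`. The coefficient of
`u⁻ᵐ` in `(u - c)⁻ˢ` vanishes for `s > m`. -/
def shiftU {A : Type*} [Ring A] [Algebra ℂ A] (c : ℂ) (f : PowerSeries A) : PowerSeries A :=
  PowerSeries.mk fun m =>
    ∑ s ∈ Finset.range (m + 1), PowerSeries.coeff m (invShift c ^ s) • PowerSeries.coeff s f

end Series

/-! ## Formal differential operators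

For a ring `B` with a derivation `δ`, a formal differential operator `∑ᵢ bᵢ ∂ⁱ` with coefficients
written on the left is recorded as the polynomial `∑ᵢ bᵢ Xⁱ`; the product of operators is not the
product of polynomials, but is governed by `∂ · b = b ∂ + δ b`. -/

section DiffOp

open Polynomial

/-- The operator `∂ · P`: `∂ · ∑ᵢ bᵢ ∂ⁱ = ∑ᵢ (bᵢ ∂ⁱ⁺¹ + δ(bᵢ) ∂ⁱ)`. -/
def derMul {B : Type*} [Ring B] (δ : B → B) (P : B[X]) : B[X] :=
  P.sum fun i b => monomial (i + 1) b + monomial i (δ b)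

/-- The product of formal differential operators, `(∑ᵢ bᵢ ∂ⁱ) · Q = ∑ᵢ bᵢ (∂ⁱ · Q)`. -/
def diffOpMul {B : Type*} [Ring B] (δ : B → B) (P Q : B[X]) : B[X] :=
  P.sum fun i b => C b * (derMul δ)^[i] Q

end DiffOp

/-! ## Tensor powers of `V = ℂᴺ`

The space `V^{⊗k}` has the basis `e_{p 0} ⊗ ⋯ ⊗ e_{p (k-1)}` indexed by `p : Fin k → Fin N`, so an
element of `End(V^{⊗k}) ⊗ A` is a matrix over `A` indexed by `Fin k → Fin N`. -/

section TensorPower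

/-- For `F ∈ End(V) ⊗ A` the element `F^{(i, k+1)} ∈ End(V^{⊗k}) ⊗ A`, in which the matrix factor
of `F` acts in the `i`-th copy of `V`. -/
def leg {N k : ℕ} {A : Type*} [Ring A] (i : Fin k) (F : Matrix (Fin N) (Fin N) A) :
    Matrix (Fin k → Fin N) (Fin k → Fin N) A :=
  Matrix.of fun p q => if ∀ j, j ≠ i → p j = q j then F (p i) (q i) else 0

/-- The matrix `M ⊗ 1`, for a complex matrix `M`. -/
def scalarMat {I : Type*} {A : Type*} [Ring A] [Algebra ℂ A] (M : Matrix I I ℂ) : Matrix I I A :=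
  M.map (algebraMap ℂ A)

/-- The skew-symmetrization projector in `V^{⊗k}`,
`e_{q 0} ⊗ ⋯ ⊗ e_{q (k-1)} ↦ (1/k!) ∑_σ sign(σ) e_{q (σ 0)} ⊗ ⋯ ⊗ e_{q (σ (k-1))}`. -/
def antisym (N k : ℕ) : Matrix (Fin k → Fin N) (Fin k → Fin N) ℂ :=
  Matrix.of fun p q =>
    (k.factorial : ℂ)⁻¹ *
      ∑ σ : Equiv.Perm (Fin k), if p = q ∘ σ then ((Equiv.Perm.sign σ : ℤ) : ℂ) else 0

end TensorPower

/-! ## The Lie algebra `gl_N` and the current algebra `gl_N[x]` -/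

/-- The Lie algebra `gl_N` over `ℂ`. -/
abbrev gl (N : ℕ) : Type := Matrix (Fin N) (Fin N) ℂ

/-- The standard generator `e_{ab}` of `gl_N`. -/
def e {N : ℕ} (a b : Fin N) : gl N := Matrix.single a b 1

/-- The current algebra `gl_N[x]` of polynomials with coefficients in `gl_N`; its bracket is the
commutator in the ring of polynomials with matrix coefficients, that is, the pointwise one. -/
abbrev current (N : ℕ) : Type := Polynomial (gl N)

/-- The evaluation homomorphism `gl_N[x] → gl_N`, `p ↦ p(y)`. -/
def currentEval (N : ℕ) (y : ℂ) : current N →ₗ⁅ℂ⁆ gl N where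
  toFun p := p.eval (algebraMap ℂ (gl N) y)
  map_add' p q := Polynomial.eval_add
  map_smul' c p := by
    simp [Polynomial.eval_smul]
  map_lie' := by
    intro p q
    have h : ∀ p q : current N, (p * q).eval (algebraMap ℂ (gl N) y)
        = p.eval (algebraMap ℂ (gl N) y) * q.eval (algebraMap ℂ (gl N) y) := fun p q =>
      Polynomial.eval₂_mul_noncomm _ _ fun k => (Algebra.commutes y _).symm
    simp only [LieRing.of_associative_ring_bracket, Polynomial.eval_sub, h]

/-! ## The Yangian `Y(gl_N)` -/

/-- In the free algebra on the `T_{ab}^{(s)}`, `s ≥ 1` (the generator `(a, b, s)` stands for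
`T_{ab}^{(s+1)}`), the element `T_{ab}^{(s)}` for `s ≥ 0`, where `T_{ab}^{(0)} = δ_{ab}`. -/
def freeT {N : ℕ} (a b : Fin N) : ℕ → FreeAlgebra ℂ (Fin N × Fin N × ℕ)
  | 0 => if a = b then 1 else 0
  | s + 1 => FreeAlgebra.ι ℂ (a, b, s)

/-- The defining relations of the Yangian: the coefficients of `u⁻ʳ v⁻ˢ` in
`(u - v) [T_{ab}(u), T_{cd}(v)] = T_{cb}(v) T_{ad}(u) - T_{cb}(u) T_{ad}(v)`. -/
inductive YangianRel (N : ℕ) :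
    FreeAlgebra ℂ (Fin N × Fin N × ℕ) → FreeAlgebra ℂ (Fin N × Fin N × ℕ) → Prop
  | rtt (a b c d : Fin N) (r s : ℕ) :
      YangianRel N
        ((freeT a b (r + 1) * freeT c d s - freeT c d s * freeT a b (r + 1))
          - (freeT a b r * freeT c d (s + 1) - freeT c d (s + 1) * freeT a b r))
        (freeT c b s * freeT a d r - freeT c b r * freeT a d s)

/-- The Yangian `Y(gl_N)`. -/
def Yangian (N : ℕ) : Type := RingQuot (YangianRel N)

instance (N : ℕ) : Ring (Yangian N) := inferInstanceAs (Ring (RingQuot (YangianRel N)))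

instance (N : ℕ) : Algebra ℂ (Yangian N) :=
  inferInstanceAs (Algebra ℂ (RingQuot (YangianRel N)))

/-- The projection of the free algebra onto the Yangian. -/
def Yangian.mk (N : ℕ) : FreeAlgebra ℂ (Fin N × Fin N × ℕ) →ₐ[ℂ] Yangian N :=
  RingQuot.mkAlgHom ℂ (YangianRel N)

/-- The element `T_{ab}^{(s)}` of the Yangian, `s ≥ 0`, with `T_{ab}^{(0)} = δ_{ab}`. -/
def Yangian.T {N : ℕ} (a b : Fin N) (s : ℕ) : Yangian N := Yangian.mk N (freeT a b s)

/-- A family of elements `t_{ab}^{(s)}` of an algebra that satisfies the relations of the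
Yangian. -/
structure IsYangianFamily {N : ℕ} {A : Type*} [Ring A] (t : Fin N → Fin N → ℕ → A) : Prop where
  zero : ∀ a b, t a b 0 = if a = b then 1 else 0
  rtt : ∀ a b c d r s,
    (t a b (r + 1) * t c d s - t c d s * t a b (r + 1))
      - (t a b r * t c d (s + 1) - t c d (s + 1) * t a b r)
      = t c b s * t a d r - t c b r * t a d s

theorem Yangian.isYangianFamily_T (N : ℕ) :
    IsYangianFamily (fun a b s => (Yangian.T a b s : Yangian N)) where
  zero a b := by
    simp only [Yangian.T, freeT]
    split_ifs <;> simp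
  rtt a b c d r s := by
    have h := RingQuot.mkAlgHom_rel ℂ (YangianRel.rtt (N := N) a b c d r s)
    have h' : Yangian.mk N _ = Yangian.mk N _ := h
    simp only [map_sub, map_mul] at h'
    exact h'

theorem IsYangianFamily.map {N : ℕ} {A B : Type*} [Ring A] [Ring B]
    {t : Fin N → Fin N → ℕ → A} (ht : IsYangianFamily t) (f : A →+* B) :
    IsYangianFamily (fun a b s => f (t a b s)) where
  zero a b := by
    simp only [ht.zero]
    split_ifs <;> simp
  rtt a b c d r s := by
    simpa only [map_sub, map_mul] using congrArg f (ht.rtt a b c d r s)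

theorem freeT_lift {N : ℕ} {A : Type*} [Ring A] [Algebra ℂ A] {t : Fin N → Fin N → ℕ → A}
    (h0 : ∀ a b, t a b 0 = if a = b then 1 else 0) (a b : Fin N) (s : ℕ) :
    FreeAlgebra.lift ℂ (fun g : Fin N × Fin N × ℕ => t g.1 g.2.1 (g.2.2 + 1)) (freeT a b s)
      = t a b s := by
  cases s with
  | zero => simp only [freeT, h0]; split_ifs <;> simp
  | succ s => simp [freeT]

/-- The homomorphism `Y(gl_N) → A` given by a family that satisfies the relations. -/
def Yangian.lift {N : ℕ} {A : Type*} [Ring A] [Algebra ℂ A] (t : Fin N → Fin N → ℕ → A)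
    (ht : IsYangianFamily t) : Yangian N →ₐ[ℂ] A :=
  RingQuot.liftAlgHom ℂ
    ⟨FreeAlgebra.lift ℂ (fun g : Fin N × Fin N × ℕ => t g.1 g.2.1 (g.2.2 + 1)), by
      rintro _ _ ⟨a, b, c, d, r, s⟩
      simp only [map_sub, map_mul, freeT_lift ht.zero]
      exact ht.rtt a b c d r s⟩

theorem Yangian.lift_T {N : ℕ} {A : Type*} [Ring A] [Algebra ℂ A] (t : Fin N → Fin N → ℕ → A)
    (ht : IsYangianFamily t) (a b : Fin N) (s : ℕ) :
    Yangian.lift t ht (Yangian.T a b s) = t a b s := by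
  have : Yangian.lift t ht (Yangian.T a b s)
      = FreeAlgebra.lift ℂ (fun g : Fin N × Fin N × ℕ => t g.1 g.2.1 (g.2.2 + 1))
        (freeT a b s) := RingQuot.liftAlgHom_mkAlgHom_apply _ _ _ _
  rw [this, freeT_lift ht.zero]

/-! ### The coproduct -/

/-- The coefficients of `∑_c P_{cb}(u) Q_{ac}(u)`. -/
def convFamily {N : ℕ} {A : Type*} [Ring A] (P Q : Fin N → Fin N → ℕ → A) :
    Fin N → Fin N → ℕ → A :=
  fun a b s => ∑ c, ∑ ij ∈ Finset.HasAntidiagonal.antidiagonal s, P c b ij.1 * Q a c ij.2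

theorem rtt_conv_aux {N : ℕ} {S : Type*} [Ring S] (D κ : S)
    (hD : ∀ x, Commute D x) (hκ : ∀ x, Commute κ x)
    (P P' Q Q' : Fin N → Fin N → S)
    (h1 : ∀ a b c d, Commute (Q a b) (P' c d)) (h2 : ∀ a b c d, Commute (Q' a b) (P c d))
    (hP : ∀ a b c d, D * (P a b * P' c d) + κ * (P c b * P' a d)
      = D * (P' c d * P a b) + κ * (P' c b * P a d))
    (hQ : ∀ a b c d, D * (Q a b * Q' c d) + κ * (Q c b * Q' a d)
      = D * (Q' c d * Q a b) + κ * (Q' c b * Q a d)) (a b c d : Fin N) :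
    D * ((∑ e, P e b * Q a e) * (∑ f, P' f d * Q' c f))
        + κ * ((∑ e, P e b * Q c e) * (∑ f, P' f d * Q' a f))
      = D * ((∑ f, P' f d * Q' c f) * (∑ e, P e b * Q a e))
        + κ * ((∑ e, P' e b * Q' c e) * (∑ f, P f d * Q a f)) := by
  have comm4 : ∀ w x y z : S, Commute x y → w * x * (y * z) = (w * y) * (x * z) := by
    intro w x y z h
    rw [mul_assoc, ← mul_assoc x, h.eq]; noncomm_ring
  have pull : ∀ c x y : S, (∀ x, Commute c x) → c * (x * y) = x * (c * y) := by
    intro c x y h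
    rw [← mul_assoc, (h x).eq, mul_assoc]
  have e1 : ∀ e f, D * (P e b * Q a e * (P' f d * Q' c f))
      + κ * (P e b * Q c e * (P' f d * Q' a f))
      = D * (P e b * P' f d * (Q' c f * Q a e)) + κ * (P e b * P' f d * (Q' c e * Q a f)) := by
    intro e f
    rw [comm4 _ _ _ _ (h1 a e f d), comm4 _ _ _ _ (h1 c e f d), pull _ _ _ hD, pull _ _ _ hκ,
      ← mul_add, hQ, mul_add, ← pull _ _ _ hD, ← pull _ _ _ hκ]
  have e2 : ∀ e f, D * (P e b * P' f d * (Q' c f * Q a e))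
      + κ * (P f b * P' e d * (Q' c f * Q a e))
      = D * (P' f d * Q' c f * (P e b * Q a e)) + κ * (P' f b * Q' c f * (P e d * Q a e)) := by
    intro e f
    rw [comm4 _ _ _ _ (h2 c f e b), comm4 _ _ _ _ (h2 c f e d)]
    simp only [← mul_assoc, ← add_mul]
    have := hP e b f d
    simp only [← mul_assoc] at this
    rw [this]
  have split : ∀ F G : Fin N → Fin N → S,
      ∑ e, ∑ f, (F e f + G e f) = ∑ e, ∑ f, F e f + ∑ e, ∑ f, G e f := by
    intro F G
    simp only [Finset.sum_add_distrib]
  have expand : ∀ (c : S) (p q : Fin N → S), c * ((∑ e, p e) * (∑ f, q f))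
      = ∑ e, ∑ f, c * (p e * q f) := by
    intro c p q
    rw [Finset.sum_mul_sum]
    simp only [Finset.mul_sum]
  rw [expand, expand, expand, expand, ← split]
  simp only [e1]
  rw [split, Finset.sum_comm (f := fun e f => κ * (P e b * P' f d * (Q' c e * Q a f))), ← split]
  simp only [e2]
  rw [split, Finset.sum_comm (f := fun e f => D * (P' f d * Q' c f * (P e b * Q a e))),
    Finset.sum_comm (f := fun e f => κ * (P' f b * Q' c f * (P e d * Q a e)))]

open PowerSeries in
/-- The series `t(u)` in two variables `u⁻¹`, `v⁻¹`. -/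
def ser1 {A : Type*} [Ring A] (t : ℕ → A) : PowerSeries (PowerSeries A) :=
  PowerSeries.mk fun r => C (t r)

/-- The series `t(v)` in two variables `u⁻¹`, `v⁻¹`. -/
def ser2 {A : Type*} [Ring A] (t : ℕ → A) : PowerSeries (PowerSeries A) :=
  PowerSeries.C (PowerSeries.mk t)

theorem coeff_ser1_mul_ser2 {A : Type*} [Ring A] (x y : ℕ → A) (r s : ℕ) :
    PowerSeries.coeff s (PowerSeries.coeff r (ser1 x * ser2 y)) = x r * y s := by
  simp [ser1, ser2]

theorem coeff_ser2_mul_ser1 {A : Type*} [Ring A] (x y : ℕ → A) (r s : ℕ) :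
    PowerSeries.coeff s (PowerSeries.coeff r (ser2 y * ser1 x)) = y s * x r := by
  simp [ser1, ser2]

theorem ser_ext_iff {A : Type*} [Ring A] (f g : PowerSeries (PowerSeries A)) :
    f = g ↔ ∀ r s, PowerSeries.coeff s (PowerSeries.coeff r f)
      = PowerSeries.coeff s (PowerSeries.coeff r g) := by
  constructor
  · rintro rfl r s
    rfl
  · intro h
    ext r s
    exact h r s

theorem rtt_iff {N : ℕ} {A : Type*} [Ring A] (t : Fin N → Fin N → ℕ → A)
    (h0 : ∀ a b, t a b 0 = if a = b then 1 else 0) (a b c d : Fin N) :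
    (∀ r s, (t a b (r + 1) * t c d s - t c d s * t a b (r + 1))
      - (t a b r * t c d (s + 1) - t c d (s + 1) * t a b r)
      = t c b s * t a d r - t c b r * t a d s) ↔
    (PowerSeries.C PowerSeries.X - PowerSeries.X : PowerSeries (PowerSeries A))
        * (ser1 (t a b) * ser2 (t c d))
        + PowerSeries.C PowerSeries.X * PowerSeries.X * (ser1 (t c b) * ser2 (t a d))
      = (PowerSeries.C PowerSeries.X - PowerSeries.X) * (ser2 (t c d) * ser1 (t a b))
        + PowerSeries.C PowerSeries.X * PowerSeries.X * (ser2 (t c b) * ser1 (t a d)) := by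
  rw [ser_ext_iff]
  constructor
  · intro h r s
    rcases r with _ | r <;> rcases s with _ | s <;>
      simp only [sub_mul, mul_assoc, map_add, map_sub, PowerSeries.coeff_C_mul,
        PowerSeries.coeff_succ_X_mul, PowerSeries.coeff_zero_X_mul, coeff_ser1_mul_ser2,
        coeff_ser2_mul_ser1, map_zero, mul_zero]
    · rw [h0 a b]; split_ifs <;> simp
    · rw [h0 c d]; split_ifs <;> simp
    · have := h r s
      rw [← sub_eq_zero] at this ⊢
      rw [← this]
      abel
  · intro h r s
    have := h (r + 1) (s + 1)
    simp only [sub_mul, mul_assoc, map_add, map_sub, PowerSeries.coeff_C_mul,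
        PowerSeries.coeff_succ_X_mul, coeff_ser1_mul_ser2,
        coeff_ser2_mul_ser1] at this
    rw [← sub_eq_zero] at this ⊢
    rw [← this]
    abel

theorem ser1_conv {A : Type*} [Ring A] {N : ℕ} (P Q : Fin N → Fin N → ℕ → A) (a b : Fin N) :
    ser1 (convFamily P Q a b) = ∑ c, ser1 (P c b) * ser1 (Q a c) := by
  rw [ser_ext_iff]
  intro r s
  simp only [map_sum, ser1, convFamily, PowerSeries.coeff_mk, PowerSeries.coeff_mul, ← map_mul]

theorem ser2_conv {A : Type*} [Ring A] {N : ℕ} (P Q : Fin N → Fin N → ℕ → A) (a b : Fin N) :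
    ser2 (convFamily P Q a b) = ∑ c, ser2 (P c b) * ser2 (Q a c) := by
  simp only [ser2, ← map_mul, ← map_sum]
  congr 1
  ext s
  simp only [map_sum, convFamily, PowerSeries.coeff_mk, PowerSeries.coeff_mul]

/-- Two families that satisfy the relations and commute with each other give a third one. -/
theorem IsYangianFamily.conv {N : ℕ} {A : Type*} [Ring A] {P Q : Fin N → Fin N → ℕ → A}
    (hP : IsYangianFamily P) (hQ : IsYangianFamily Q)
    (hPQ : ∀ a b r c d s, Commute (P a b r) (Q c d s)) :
    IsYangianFamily (convFamily P Q) := by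
  have h0 : ∀ a b, convFamily P Q a b 0 = if a = b then 1 else 0 := by
    intro a b
    simp [convFamily, hP.zero, hQ.zero]
  refine ⟨h0, fun a b c d => ?_⟩
  rw [rtt_iff _ h0]
  simp only [ser1_conv, ser2_conv]
  have cX : ∀ x : PowerSeries (PowerSeries A), Commute (PowerSeries.C PowerSeries.X) x := by
    intro x
    ext r : 1
    rw [PowerSeries.coeff_C_mul, PowerSeries.coeff_mul_C]
    exact (PowerSeries.commute_X _).symm
  have X' : ∀ x : PowerSeries (PowerSeries A), Commute PowerSeries.X x := fun x =>
    (PowerSeries.commute_X x).symm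
  refine rtt_conv_aux _ _ (fun x => (cX x).sub_left (X' x)) (fun x => (cX x).mul_left (X' x))
    (fun a b => ser1 (P a b)) (fun a b => ser2 (P a b)) (fun a b => ser1 (Q a b))
    (fun a b => ser2 (Q a b)) ?_ ?_ ?_ ?_ a b c d
  · intro a b c d
    refine (ser_ext_iff _ _).2 fun r s => ?_
    rw [coeff_ser1_mul_ser2, coeff_ser2_mul_ser1]
    exact (hPQ _ _ _ _ _ _).symm
  · intro a b c d
    refine (ser_ext_iff _ _).2 fun r s => ?_
    rw [coeff_ser1_mul_ser2, coeff_ser2_mul_ser1]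
    exact (hPQ _ _ _ _ _ _).symm
  · exact fun a b c d => (rtt_iff P hP.zero a b c d).1 (hP.rtt a b c d)
  · exact fun a b c d => (rtt_iff Q hQ.zero a b c d).1 (hQ.rtt a b c d)

/-- The coproduct of the Yangian, `Δ(T_{ab}(u)) = ∑_c T_{cb}(u) ⊗ T_{ac}(u)`. -/
def Yangian.comul (N : ℕ) : Yangian N →ₐ[ℂ] Yangian N ⊗[ℂ] Yangian N :=
  Yangian.lift
    (convFamily (fun a b s => Yangian.T a b s ⊗ₜ 1) (fun a b s => 1 ⊗ₜ Yangian.T a b s))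
    (IsYangianFamily.conv
      ((Yangian.isYangianFamily_T N).map
        (Algebra.TensorProduct.includeLeft : Yangian N →ₐ[ℂ] Yangian N ⊗[ℂ] Yangian N).toRingHom)
      ((Yangian.isYangianFamily_T N).map
        (Algebra.TensorProduct.includeRight : Yangian N →ₐ[ℂ] Yangian N ⊗[ℂ] Yangian N).toRingHom)
      fun a b r c d s => by
        simp [Commute, SemiconjBy, Algebra.TensorProduct.tmul_mul_tmul])

/-- The counit of the Yangian, `T_{ab}(u) ↦ δ_{ab}`. -/
def Yangian.counit (N : ℕ) : Yangian N →ₐ[ℂ] ℂ :=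
  Yangian.lift (fun a b s => if s = 0 then (if a = b then 1 else 0) else 0)
    { zero := fun a b => by simp
      rtt := fun a b c d r s => by
        rcases r with _ | r <;> rcases s with _ | s <;> simp [mul_comm] }

/-! ### Evaluation -/

/-- The evaluation homomorphism `Y(gl_N) → U(gl_N)` at the point `x`,
`T_{ab}(u) ↦ δ_{ab} + e_{ba} (u - x)⁻¹ = δ_{ab} + ∑_{s ≥ 1} xˢ⁻¹ e_{ba} u⁻ˢ`; it is the composition
of the automorphism `T(u) ↦ T(u - x)` with the map `T_{ab}(u) ↦ δ_{ab} + e_{ba} u⁻¹`. -/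
def Yangian.eval (N : ℕ) (x : ℂ) : Yangian N →ₐ[ℂ] UniversalEnvelopingAlgebra ℂ (gl N) :=
  Yangian.lift
    (fun a b s =>
      match s with
      | 0 => if a = b then 1 else 0
      | s + 1 => x ^ s • UniversalEnvelopingAlgebra.ι ℂ (e b a))
    { zero := fun a b => rfl
      rtt := fun a b c d r s => by
        have hc : ∀ a b c d : Fin N,
            UniversalEnvelopingAlgebra.ι ℂ (e b a) * UniversalEnvelopingAlgebra.ι ℂ (e d c)
              - UniversalEnvelopingAlgebra.ι ℂ (e d c) * UniversalEnvelopingAlgebra.ι ℂ (e b a)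
            = (if a = d then UniversalEnvelopingAlgebra.ι ℂ (e b c) else 0)
              - (if c = b then UniversalEnvelopingAlgebra.ι ℂ (e d a) else 0) := by
          intro a b c d
          rw [← LieRing.of_associative_ring_bracket, ← LieHom.map_lie,
            LieRing.of_associative_ring_bracket]
          by_cases h1 : a = d <;> by_cases h2 : c = b <;>
            simp [e, h1, h2, Matrix.single_mul_single_same, Matrix.single_mul_single_of_ne]
        rcases r with _ | r <;> rcases s with _ | s
        · dsimp only
          split_ifs <;> simp
        · dsimp only
          rw [pow_zero, one_smul, mul_smul_comm, smul_mul_assoc, ← smul_sub, hc, smul_sub]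
          by_cases h1 : a = d <;> by_cases h2 : c = b <;> by_cases h3 : a = b <;>
            simp [h1, h2, h3]
        · dsimp only
          rw [pow_zero, one_smul, mul_smul_comm (x ^ r), smul_mul_assoc (x ^ r), ← smul_sub (x ^ r),
            hc, smul_sub]
          by_cases h1 : a = d <;> by_cases h2 : c = b <;> by_cases h3 : c = d <;>
            simp [h1, h2, h3]
        · dsimp only
          simp only [smul_mul_smul_comm, ← pow_add]
          rw [show r + 1 + s = s + r + 1 by ring, show s + (r + 1) = s + r + 1 by ring,
            show r + (s + 1) = s + r + 1 by ring, show s + 1 + r = s + r + 1 by ring,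
            show r + s = s + r by ring]
          simp }

/-! ## Tensor products of modules -/

section Modules

variable {N n : ℕ} (M : Fin n → Type*) [∀ i, AddCommGroup (M i)] [∀ i, Module ℂ (M i)]

/-- For `X ∈ End(M_i)` the operator `X^{(i)} = 1^{⊗(i-1)} ⊗ X ⊗ 1^{⊗(n-i)}` in
`M_1 ⊗ ⋯ ⊗ M_n`. -/
def onFactor (i : Fin n) : Module.End ℂ (M i) →ₐ[ℂ] Module.End ℂ (⨂[ℂ] j, M j) :=
  AlgHom.ofLinearMap
    { toFun := fun X => PiTensorProduct.map
        (Function.update (fun j => (LinearMap.id : M j →ₗ[ℂ] M j)) i X)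
      map_add' := fun X Y => PiTensorProduct.map_update_add _ i X Y
      map_smul' := fun c X => PiTensorProduct.map_update_smul _ i c X }
    (by
      change PiTensorProduct.map _ = 1
      rw [show (1 : Module.End ℂ (M i)) = (fun j => (LinearMap.id : M j →ₗ[ℂ] M j)) i from rfl,
        Function.update_eq_self]
      exact PiTensorProduct.map_id)
    (by
      intro X Y
      change PiTensorProduct.map _ = PiTensorProduct.map _ * PiTensorProduct.map _
      rw [← PiTensorProduct.map_mul]
      congr 1
      funext j
      by_cases h : j = i
      · subst h
        simp
      · simp [h, Module.End.mul_eq_comp])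

theorem onFactor_commute {i j : Fin n} (h : i ≠ j) (X : Module.End ℂ (M i))
    (Y : Module.End ℂ (M j)) : Commute (onFactor M i X) (onFactor M j Y) := by
  change PiTensorProduct.map _ * PiTensorProduct.map _
    = PiTensorProduct.map _ * PiTensorProduct.map _
  rw [← PiTensorProduct.map_mul, ← PiTensorProduct.map_mul]
  congr 1
  funext k
  by_cases hi : k = i
  · subst hi
    simp [h, Module.End.mul_eq_comp]
  · by_cases hj : k = j
    · subst hj
      simp [hi, Module.End.mul_eq_comp]
    · simp [hi, hj, Module.End.mul_eq_comp]

/-- Given homomorphisms `φ_1, …, φ_n : Y(gl_N) → A` with pairwise commuting images, the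
homomorphism `m ∘ (φ_1 ⊗ ⋯ ⊗ φ_n) ∘ Δ^{(n)}`, where `Δ^{(n)}` is the iterated coproduct and `m` is
the multiplication. The property carried along serves the recursion. -/
def tensorHom {A : Type*} [Ring A] [Algebra ℂ A] : (n : ℕ) → (φ : Fin n → Yangian N →ₐ[ℂ] A) →
    (∀ i j, i ≠ j → ∀ x y, Commute (φ i x) (φ j y)) →
    {ψ : Yangian N →ₐ[ℂ] A // ∀ b, (∀ i x, Commute (φ i x) b) → ∀ x, Commute (ψ x) b}
  | 0, _, _ => ⟨(Algebra.ofId ℂ A).comp (Yangian.counit N), fun b _ x =>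
      Algebra.commutes (Yangian.counit N x) b⟩
  | n + 1, φ, hφ =>
    let ψ := tensorHom n (fun i => φ i.succ)
      fun i j hij => hφ i.succ j.succ fun h => hij (Fin.succ_injective n h)
    let h : ∀ x y, Commute (φ 0 x) (ψ.1 y) := fun x y =>
      (ψ.2 (φ 0 x) (fun i w => hφ i.succ 0 (Fin.succ_ne_zero i) w x) y).symm
    ⟨(Algebra.TensorProduct.lift (φ 0) ψ.1 h).comp (Yangian.comul N), fun b hb x => by
      have key : ∀ t : Yangian N ⊗[ℂ] Yangian N,
          Commute (Algebra.TensorProduct.lift (φ 0) ψ.1 h t) b := by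
        intro t
        induction t using TensorProduct.induction_on with
        | zero => rw [map_zero]; exact Commute.zero_left b
        | tmul y w =>
          rw [Algebra.TensorProduct.lift_tmul]
          exact (hb 0 y).mul_left (ψ.2 b (fun i => hb i.succ) w)
        | add t₁ t₂ h₁ h₂ => rw [map_add]; exact h₁.add_left h₂
      exact key (Yangian.comul N x)⟩

variable [∀ i, LieRingModule (gl N) (M i)] [∀ i, LieModule ℂ (gl N) (M i)]

/-- The action of `Y(gl_N)` on the evaluation module `M_i(z_i)`. -/
def evalAction (z : Fin n → ℂ) (i : Fin n) : Yangian N →ₐ[ℂ] Module.End ℂ (M i) :=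
  (UniversalEnvelopingAlgebra.lift ℂ (LieModule.toEnd ℂ (gl N) (M i))).comp
    (Yangian.eval N (z i))

/-- The action of `Y(gl_N)` on the tensor product `M_1(z_1) ⊗ ⋯ ⊗ M_n(z_n)` of evaluation
modules. -/
def yangianAction (z : Fin n → ℂ) : Yangian N →ₐ[ℂ] Module.End ℂ (⨂[ℂ] j, M j) :=
  (tensorHom n (fun i => (onFactor M i).comp (evalAction M z i))
    fun _ _ hij _ _ => onFactor_commute M hij _ _).1

/-- The action of `gl_N[x]` on the tensor product `M_1(z_1) ⊗ ⋯ ⊗ M_n(z_n)` of evaluation modules: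
`p` acts as `∑_i p(z_i)^{(i)}`. -/
def currentRep (z : Fin n → ℂ) : current N →ₗ⁅ℂ⁆ Module.End ℂ (⨂[ℂ] j, M j) where
  toFun p := ∑ i, onFactor M i (LieModule.toEnd ℂ (gl N) (M i) (currentEval N (z i) p))
  map_add' p q := by simp [Finset.sum_add_distrib]
  map_smul' c p := by simp [Finset.smul_sum]
  map_lie' := by
    intro p q
    rw [LieRing.of_associative_ring_bracket (A := Module.End ℂ (⨂[ℂ] j, M j)),
      Finset.sum_mul_sum, Finset.sum_mul_sum, Finset.sum_comm (s := Finset.univ) (t := Finset.univ)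
        (f := fun i j => onFactor M i (LieModule.toEnd ℂ (gl N) (M i) (currentEval N (z i) q))
          * onFactor M j (LieModule.toEnd ℂ (gl N) (M j) (currentEval N (z j) p))),
      ← Finset.sum_sub_distrib]
    refine Finset.sum_congr rfl fun i _ => ?_
    rw [← Finset.sum_sub_distrib, Finset.sum_eq_single i]
    · rw [LieHom.map_lie, LieHom.map_lie, LieRing.of_associative_ring_bracket, map_sub, map_mul,
        map_mul]
    · intro j _ hj
      exact sub_eq_zero.2 (onFactor_commute M hj.symm _ _)
    · intro h
      exact absurd (Finset.mem_univ i) h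

/-- The action of `U(gl_N[x])` on the tensor product `M_1(z_1) ⊗ ⋯ ⊗ M_n(z_n)` of evaluation
modules. -/
def currentAction (z : Fin n → ℂ) :
    UniversalEnvelopingAlgebra ℂ (current N) →ₐ[ℂ] Module.End ℂ (⨂[ℂ] j, M j) :=
  UniversalEnvelopingAlgebra.lift ℂ (currentRep M z)

/-- The operator `e_{ab}^{(i)}` in `M_1 ⊗ ⋯ ⊗ M_n`. -/
def eAt (i : Fin n) (a b : Fin N) : Module.End ℂ (⨂[ℂ] j, M j) :=
  onFactor M i (LieModule.toEnd ℂ (gl N) (M i) (e a b))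

/-- The operator by which `e_{ab}` acts in `M_1 ⊗ ⋯ ⊗ M_n`. -/
def eTot (a b : Fin N) : Module.End ℂ (⨂[ℂ] j, M j) := ∑ i, eAt M i a b

/-- The rational dynamical Hamiltonian
`G_{a,K}(z) = ∑_i z_i e_{aa}^{(i)} + ∑_{b ≠ a} (e_{ab} e_{ba} - e_{aa}) / (K_a - K_b)`. -/
def ratHam (K : Fin N → ℂ) (z : Fin n → ℂ) (a : Fin N) : Module.End ℂ (⨂[ℂ] j, M j) :=
  ∑ i, z i • eAt M i a a
    + ∑ b ∈ Finset.univ.erase a,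
        (1 / (K a - K b)) • (eTot M a b * eTot M b a - eTot M a a)

/-- The trigonometric dynamical Hamiltonian
`X_{a,K}(z) = - e_{aa}² / 2 + ∑_i z_i e_{aa}^{(i)} + ∑_b ∑_{i < j} e_{ab}^{(i)} e_{ba}^{(j)}
  + ∑_{b ≠ a} K_b / (K_a - K_b) (e_{ab} e_{ba} - e_{aa})`. -/
def trigHam (K : Fin N → ℂ) (z : Fin n → ℂ) (a : Fin N) : Module.End ℂ (⨂[ℂ] j, M j) :=
  -((1 / 2 : ℂ) • (eTot M a a) ^ 2) + ∑ i, z i • eAt M i a a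
    + ∑ b, ∑ i, ∑ j ∈ Finset.Ioi i, eAt M i a b * eAt M j b a
    + ∑ b ∈ Finset.univ.erase a,
        (K b / (K a - K b)) • (eTot M a b * eTot M b a - eTot M a a)

end Modules

/-! ## Transfer matrices -/

section Transfer

/-- The matrix of the operator `Q^{⊗k}` in `V^{⊗k}`. -/
def tensorPow {N : ℕ} (k : ℕ) (Q : Matrix (Fin N) (Fin N) ℂ) :
    Matrix (Fin k → Fin N) (Fin k → Fin N) ℂ :=
  Matrix.of fun p q => ∏ i, Q (p i) (q i)

/-- The series `T(u) = ∑ E_{ab} ⊗ T_{ab}(u)`, where `T_{ab}(u) = ∑ₛ T_{ab}^{(s)} u⁻ˢ`. -/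
def serT (N : ℕ) : Matrix (Fin N) (Fin N) (PowerSeries (Yangian N)) :=
  Matrix.of fun a b => PowerSeries.mk fun s => Yangian.T a b s

/-- The series `T^{(k,k+1)}(u) T^{(k-1,k+1)}(u-1) ⋯ T^{(1,k+1)}(u-k+1)` with coefficients in
`End(V^{⊗k}) ⊗ Y(gl_N)`. -/
def fusedT (N k : ℕ) :
    Matrix (Fin k → Fin N) (Fin k → Fin N) (PowerSeries (Yangian N)) :=
  (List.ofFn fun j : Fin k => leg j.rev ((serT N).map (shiftU ((j : ℕ) : ℂ)))).prod

/-- The transfer matrix `T_{k,Q}(u) = (tr_{Λᵏ V} ⊗ id)(Q^{∧k} T^{∧k}(u))`, a series in `u⁻¹` with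
coefficients in `Y(gl_N)`. Here `Q^{∧k}` and `T^{∧k}(u)` are the restrictions to `Λᵏ V` of `Q^{⊗k}`
and of the series `fusedT`; the trace over `Λᵏ V`, the image of the projector `antisym`, of the
restriction of an operator `Z` in `V^{⊗k}` that preserves `Λᵏ V` is the trace of `Z * antisym`.
For `k = 0` one gets `1`. -/
def xxxTransfer {N : ℕ} (k : ℕ) (Q : Matrix (Fin N) (Fin N) ℂ) : PowerSeries (Yangian N) :=
  Matrix.trace (scalarMat (tensorPow k Q) * fusedT N k * scalarMat (antisym N k))

/-- The series `L(u) = ∑ E_{ab} ⊗ L_{ab}(u)`, where `L_{ab}(u) = ∑_{s ≥ 0} (e_{ba} xˢ) u⁻ˢ⁻¹`. -/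
def serL (N : ℕ) :
    Matrix (Fin N) (Fin N) (PowerSeries (UniversalEnvelopingAlgebra ℂ (current N))) :=
  Matrix.of fun a b => PowerSeries.mk fun m =>
    match m with
    | 0 => 0
    | s + 1 => UniversalEnvelopingAlgebra.ι ℂ (Polynomial.monomial s (e b a) : current N)

open Polynomial in
/-- The formal differential operator
`(∂_u - K^{(1)} - L^{(1,N+1)}(u)) ⋯ (∂_u - K^{(N)} - L^{(N,N+1)}(u)) · A`, where `A` is the
skew-symmetrization projector in `V^{⊗N}`, with coefficients in `End(V^{⊗N}) ⊗ U(gl_N[x])[[u⁻¹]]`;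
the derivation `d/du` of the coefficients is taken entrywise. -/
def gaudinDiffOpMat {N : ℕ} (K : Matrix (Fin N) (Fin N) ℂ) :
    (Matrix (Fin N → Fin N) (Fin N → Fin N)
      (PowerSeries (UniversalEnvelopingAlgebra ℂ (current N))))[X] :=
  (List.ofFn fun i : Fin N => X - C (leg i (scalarMat K)) - C (leg i (serL N))).foldr
    (diffOpMul fun F => F.map derivU) (C (scalarMat (antisym N N)))

/-- The Gaudin transfer matrix `𝒢_{k,K}(u)`, a series in `u⁻¹` with coefficients in `U(gl_N[x])`:
`(-1)ᵏ` times the coefficient of `∂_u^{N-k}` in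
`𝒟_K(u, ∂_u) = (tr_{V^{⊗N}} ⊗ id)((∂_u - K^{(1)} - L^{(1,N+1)}(u)) ⋯ A)`, `0 ≤ k ≤ N`. -/
def gaudinTransfer {N : ℕ} (k : ℕ) (K : Matrix (Fin N) (Fin N) ℂ) :
    PowerSeries (UniversalEnvelopingAlgebra ℂ (current N)) :=
  (-1) ^ k * Matrix.trace ((gaudinDiffOpMat K).coeff (N - k))

variable {N n : ℕ} (M : Fin n → Type*) [∀ i, AddCommGroup (M i)] [∀ i, Module ℂ (M i)]
  [∀ i, LieRingModule (gl N) (M i)] [∀ i, LieModule ℂ (gl N) (M i)]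

/-- The transfer matrix of the Gaudin model, `𝒢_{k,K}(u)` acting in
`M_1(z_1) ⊗ ⋯ ⊗ M_n(z_n)`. -/
def gaudinOp (z : Fin n → ℂ) (k : ℕ) (K : Matrix (Fin N) (Fin N) ℂ) :
    PowerSeries (Module.End ℂ (⨂[ℂ] j, M j)) :=
  PowerSeries.map (currentAction M z).toRingHom (gaudinTransfer k K)

/-- The transfer matrix of the XXX-type model, `T_{k,Q}(u)` acting in
`M_1(z_1) ⊗ ⋯ ⊗ M_n(z_n)`. -/
def xxxOp (z : Fin n → ℂ) (k : ℕ) (Q : Matrix (Fin N) (Fin N) ℂ) :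
    PowerSeries (Module.End ℂ (⨂[ℂ] j, M j)) :=
  PowerSeries.map (yangianAction M z).toRingHom (xxxTransfer k Q)

/-- The generating function
`∑_{k=0}^N (-1)ᵏ 𝒢_{k,K}(u; z) x^{N-k} ∏_a 1 / (x - K_a)` for `K = ∑ K_a E_{aa}`. -/
def gaudinGen (K : Fin N → ℂ) (z : Fin n → ℂ) (x : ℂ) :
    PowerSeries (Module.End ℂ (⨂[ℂ] j, M j)) :=
  ∑ k ∈ Finset.range (N + 1),
    ((-1) ^ k * x ^ (N - k) * ∏ a, 1 / (x - K a)) • gaudinOp M z k (Matrix.diagonal K)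

/-- The generating function
`∑_{k=0}^N (-1)ᵏ T_{k,K}(u; z) x^{N-k} ∏_a 1 / (x - K_a)` for `K = ∑ K_a E_{aa}`. -/
def xxxGen (K : Fin N → ℂ) (z : Fin n → ℂ) (x : ℂ) :
    PowerSeries (Module.End ℂ (⨂[ℂ] j, M j)) :=
  ∑ k ∈ Finset.range (N + 1),
    ((-1) ^ k * x ^ (N - k) * ∏ a, 1 / (x - K a)) • xxxOp M z k (Matrix.diagonal K)

end Transfer

end DynHam

end

open DynHam

/-! Both generating functions are built from one alternating sum, `altSum`: the trace over `V^{⊗k}`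
of an ordered product of operators, one in each tensor factor, against the skew-symmetrizer. All
entries of these operators have the form `δ_{ab} + O(u⁻¹)`. For XXX they are multiplications by
`T_{ab}(u - j)`. For Gaudin, substituting the number `x` for `∂` turns left multiplication by `∂`
into `x + d/du` (`eval_derMul`), so the factors are `δ_{ab} (x - K_a + d/du) - L_{ab}(u)`,
normalized by `x - K_a`.

In the coefficient of `u⁻ᵐ` at most `m` factors contribute more than `δ_{ab}`. For `m ≤ 2` only the
identity and single transpositions survive in the sum over permutations, and what remains is a sum
over subsets of indices of one-index terms and 2×2 minors (`coeff_two_altSum`). For Gaudin only the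
full index set occurs; for XXX the sum over all subsets, weighted by powers of `x`, factorizes
(`sum_subsetWeight_superset`).

The shift `u - j` in one model and `d/du` in the other add the same correction `e_{bb}` to the minor
`e_{aa} e_{bb} - e_{ba} e_{ab}`. The result is minus `e_{ab} e_{ba} - e_{aa} - e_{aa} e_{bb}`, an
operator symmetric in `a, b` (`pairOp_eq`, `pairOp_symm`). Partial fractions then distribute each
pair over its two poles `K_a`, `K_b` (`neg_sum_smul_pair_eq`); this is where distinctness of the
`K_a` enters. The one-index term in XXX is `T_{aa}^{(2)}`, whose iterated coproduct yields the `z_i`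
part and the `i < j` part of the Hamiltonian (`yangianAction_T_two`). -/

open DynHam

namespace DynHam

/-! ### Ordered products of operators acting in the factors of a tensor power. -/

section Legs

variable {N k : ℕ} {S : Type*} [AddCommGroup S] [Module ℂ S]

/-- The action of a matrix `G` of operators on `S` in the `l`-th tensor factor of `V^{⊗k}`. -/
def legAct (l : Fin k) (G : Fin N → Fin N → Module.End ℂ S)
    (Z : Matrix (Fin k → Fin N) (Fin k → Fin N) S) :
    Matrix (Fin k → Fin N) (Fin k → Fin N) S :=
  Matrix.of fun p q => ∑ b, G (p l) b (Z (Function.update p l b) q)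

/-- Each tensor factor is touched at most once, so every entry can be read off the initial row index
`p` and a single final row index `r`, which must agree with `p` on the untouched factors. -/
theorem foldr_legAct (π : Fin k → Fin k) (hπ : Function.Injective π)
    (G : Fin k → Fin N → Fin N → Module.End ℂ S)
    (Z : Matrix (Fin k → Fin N) (Fin k → Fin N) S) (ls : List (Fin k)) (hls : ls.Nodup)
    (p q : Fin k → Fin N) :
    ls.foldr (fun j => legAct (π j) (G j)) Z p q
      = ∑ r : Fin k → Fin N, if ∀ l ∉ ls.map π, p l = r l then
          (ls.map fun j => G j (p (π j)) (r (π j))).prod (Z r q) else 0 := by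
  induction ls generalizing p with
  | nil =>
    rw [Finset.sum_eq_single p]
    · simp
    · intro r _ hr
      rw [if_neg]
      exact fun h => hr (funext fun l => (h l (by simp)).symm)
    · simp
  | cons j ls ih =>
    obtain ⟨hj, hls⟩ := List.nodup_cons.1 hls
    have hj' : π j ∉ ls.map π := by
      rw [List.mem_map_of_injective hπ]
      exact hj
    simp only [List.foldr_cons, legAct, Matrix.of_apply] at ih ⊢
    simp only [ih hls, map_sum]
    rw [Finset.sum_comm]
    refine Finset.sum_congr rfl fun r _ => ?_
    -- The later operators leave factor `π j` alone, so the intermediate index there is already the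
    -- final one.
    rw [Finset.sum_eq_single (r (π j))]
    · have hiff : (∀ l ∉ ls.map π, Function.update p (π j) (r (π j)) l = r l)
          ↔ ∀ l ∉ (j :: ls).map π, p l = r l := by
        refine forall_congr' fun l => ?_
        by_cases h : l = π j
        · subst h
          simp
        · simp [h]
      rw [if_congr hiff rfl rfl]
      split_ifs
      · rw [List.map_cons, List.prod_cons, Module.End.mul_apply]
        congr 2
        congr 1
        refine List.map_congr_left fun i hi => ?_
        rw [Function.update_of_ne]
        exact fun h => hj (hπ h ▸ hi)
      · simp
    · intro b _ hb
      rw [if_neg, map_zero]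
      intro h
      have := h _ hj'
      rw [Function.update_self] at this
      exact hb this
    · simp

theorem foldr_finRange_legAct (π : Equiv.Perm (Fin k))
    (G : Fin k → Fin N → Fin N → Module.End ℂ S)
    (Z : Matrix (Fin k → Fin N) (Fin k → Fin N) S) (p q : Fin k → Fin N) :
    (List.finRange k).foldr (fun j => legAct (π j) (G j)) Z p q
      = ∑ r : Fin k → Fin N, (List.ofFn fun j => G j (p (π j)) (r (π j))).prod (Z r q) := by
  rw [foldr_legAct π π.injective G Z _ (List.nodup_finRange k)]
  refine Finset.sum_congr rfl fun r _ => ?_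
  rw [if_pos, List.ofFn_eq_map]
  intro l hl
  refine absurd ?_ hl
  rw [List.mem_map]
  exact ⟨π.symm l, List.mem_finRange _, by simp⟩

/-- The weighted trace of an ordered product of operators acting in the factors of `V^{⊗k}`
followed by the skew-symmetrization projector. -/
theorem sum_foldr_legAct_antisym (π : Equiv.Perm (Fin k))
    (G : Fin k → Fin N → Fin N → Module.End ℂ S) (s : S) (w : Fin N → ℂ) :
    ∑ p : Fin k → Fin N, (∏ l, w (p l)) •
        (List.finRange k).foldr (fun j => legAct (π j) (G j))
          (Matrix.of fun r q => antisym N k r q • s) p p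
      = (k.factorial : ℂ)⁻¹ • ∑ p : Fin k → Fin N, (∏ l, w (p l)) •
          ∑ σ : Equiv.Perm (Fin k), ((Equiv.Perm.sign σ : ℤ) : ℂ) •
            (List.ofFn fun j => G j (p j) (p (σ j))).prod s := by
  rw [Finset.smul_sum]
  -- Relabelling `p` by `π`, and below conjugating `σ` by `π⁻¹`, removes `π` without changing
  -- weights or signs: it does not matter which tensor factor each operator occupies.
  refine Fintype.sum_equiv (Equiv.arrowCongr π.symm (Equiv.refl _)) _ _ fun p => ?_
  rw [foldr_finRange_legAct]
  have hw : ∏ l, w ((Equiv.arrowCongr π.symm (Equiv.refl _)) p l) = ∏ l, w (p l) :=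
    Fintype.prod_equiv π _ _ fun l => by simp
  rw [hw, smul_comm]
  congr 1
  simp only [Matrix.of_apply, antisym, mul_smul, Finset.sum_smul, map_smul, map_sum]
  rw [← Finset.smul_sum]
  congr 1
  rw [Finset.sum_comm]
  refine Fintype.sum_equiv (MulAut.conj π⁻¹).toEquiv _ _ fun σ => ?_
  rw [Finset.sum_eq_single (p ∘ σ)]
  · have hs : ((Equiv.Perm.sign π : ℤ) : ℂ) * (Equiv.Perm.sign π : ℤ) = 1 := by
      rw [← Int.cast_mul, ← Units.val_mul, Int.units_mul_self]
      simp
    simp [Equiv.Perm.mul_apply, mul_right_comm _ _ ((Equiv.Perm.sign π : ℤ) : ℂ), hs]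
  · intro r _ hr
    simp [hr]
  · simp

end Legs

/-! ### Alternating sums, and permutations moving at most two points. -/

section Alternating

variable {N k : ℕ} {S : Type*} [AddCommGroup S] [Module ℂ S]

/-- If `p i = p j`, left multiplication of `σ` by the transposition of `i` and `j` preserves `p ∘ σ`
and flips the sign, so terms cancel in pairs. -/
theorem sum_sign_smul_eq_zero (p : Fin k → Fin N) (hp : ¬ Function.Injective p)
    (f : (Fin k → Fin N) → S) :
    ∑ σ : Equiv.Perm (Fin k), ((Equiv.Perm.sign σ : ℤ) : ℂ) • f (p ∘ σ) = 0 := by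
  obtain ⟨i, j, hij, hne⟩ : ∃ i j, p i = p j ∧ i ≠ j := by
    simpa [Function.Injective] using hp
  have hps : p ∘ Equiv.swap i j = p := by
    funext l
    simp only [Function.comp_apply, Equiv.swap_apply_def]
    split_ifs with h1 h2
    · rw [h1, hij]
    · rw [h2, hij]
    · rfl
  refine Finset.sum_involution (fun σ _ => Equiv.swap i j * σ) ?_ ?_ ?_ ?_
  · intro σ _
    have : p ∘ (Equiv.swap i j * σ : Equiv.Perm (Fin k)) = p ∘ σ := by
      rw [Equiv.Perm.coe_mul, ← Function.comp_assoc, hps]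
    rw [this, ← add_smul]
    simp [Equiv.Perm.sign_mul, Equiv.Perm.sign_swap hne]
  · intro σ _ _ h
    have := congrArg Equiv.Perm.sign h
    simp only [Equiv.Perm.sign_mul, Equiv.Perm.sign_swap hne] at this
    rcases Int.units_eq_one_or (Equiv.Perm.sign σ) with h | h <;> simp [h] at this
  · intro σ _
    exact Finset.mem_univ _
  · intro σ _
    simp

/-- The case `i = j` is allowed; it serves the collapse with a single exceptional position. -/
theorem perm_fix_off_pair {i j : Fin k} (σ : Equiv.Perm (Fin k)) :
    (∀ l, l = i ∨ l = j ∨ σ l = l) ↔ σ = 1 ∨ σ = Equiv.swap i j := by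
  constructor
  · intro h
    by_cases hi : σ i = i
    · left
      ext l : 1
      rcases h l with rfl | rfl | h1
      · simpa using hi
      · rcases h (σ l) with h2 | h2 | h2
        · rw [← h2] at hi
          simp [σ.injective hi]
        · simpa using h2
        · simpa using σ.injective h2
      · simpa using h1
    · right
      have hij : σ i = j := by
        rcases h (σ i) with h1 | h1 | h1
        · exact absurd h1 hi
        · exact h1
        · exact absurd (σ.injective h1) hi
      have hji : σ j = i := by
        rcases h (σ j) with h1 | h1 | h1
        · exact h1
        · rw [← hij] at h1
          exact absurd (σ.injective h1) hi
        · have h2 := σ.injective h1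
          exact absurd (σ.injective (hij.trans h2.symm)) (fun h3 => hi (by rw [hij, h3]))
      ext l : 1
      rcases h l with rfl | rfl | h1
      · simp [hij]
      · simp [hji]
      · rw [h1, Equiv.swap_apply_of_ne_of_ne]
        · rintro rfl
          exact hi h1
        · rintro rfl
          rw [h1] at hji
          exact hi (hij.trans hji)
  · rintro (rfl | rfl) l
    · simp
    · by_cases h1 : l = i
      · exact Or.inl h1
      · by_cases h2 : l = j
        · exact Or.inr (Or.inl h2)
        · exact Or.inr (Or.inr (Equiv.swap_apply_of_ne_of_ne h1 h2))

end Alternating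

/-! ### Low-order coefficients of an ordered product applied to 1. -/

section Expansion

open PowerSeries

variable {k : ℕ} {R : Type*} [Ring R] [Algebra ℂ R]

theorem coeff_zero_prod_ofFn (b : Fin k → ℂ) (G : Fin k → Module.End ℂ (PowerSeries R))
    (h0 : ∀ j s, coeff 0 (G j s) = b j • coeff 0 s) :
    coeff 0 ((List.ofFn G).prod 1) = (∏ j, b j) • (1 : R) := by
  induction k with
  | zero => simp
  | succ k ih =>
    rw [List.ofFn_succ, List.prod_cons, Module.End.mul_apply, h0,
      ih (fun j => b j.succ) (fun j => G j.succ) (fun j => h0 j.succ), Fin.prod_univ_succ, mul_smul]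

theorem coeff_one_prod_ofFn (b : Fin k → ℂ) (P : Fin k → R)
    (G : Fin k → Module.End ℂ (PowerSeries R))
    (h0 : ∀ j s, coeff 0 (G j s) = b j • coeff 0 s)
    (h1 : ∀ j s, coeff 1 (G j s) = b j • coeff 1 s + P j * coeff 0 s) :
    coeff 1 ((List.ofFn G).prod 1) = ∑ j, (∏ l, if l = j then 1 else b l) • P j := by
  induction k with
  | zero => simp [coeff_one]
  | succ k ih =>
    rw [List.ofFn_succ, List.prod_cons, Module.End.mul_apply, h1,
      ih (fun j => b j.succ) (fun j => P j.succ) (fun j => G j.succ) (fun j => h0 j.succ)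
        (fun j => h1 j.succ),
      coeff_zero_prod_ofFn (fun j => b j.succ) (fun j => G j.succ) (fun j => h0 j.succ)]
    simp only [Fin.sum_univ_succ, Fin.prod_univ_succ, Fin.succ_ne_zero, Fin.succ_inj,
      (Fin.succ_ne_zero _).symm, if_true, if_false, mul_smul, Finset.smul_sum, one_smul,
      mul_smul_comm, mul_one]
    rw [add_comm]

/-- `P'` may differ from `P` because `d/du` sends `u⁻¹` to `-u⁻²` while producing no first-order
term. The leftmost operator acts last, so in a pair `i < j` it is the `i`-th that acts on a
first-order input. -/
theorem coeff_two_prod_ofFn (b : Fin k → ℂ) (P P' Q : Fin k → R)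
    (G : Fin k → Module.End ℂ (PowerSeries R))
    (h0 : ∀ j s, coeff 0 (G j s) = b j • coeff 0 s)
    (h1 : ∀ j s, coeff 1 (G j s) = b j • coeff 1 s + P j * coeff 0 s)
    (h2 : ∀ j s, coeff 2 (G j s) = b j • coeff 2 s + P' j * coeff 1 s + Q j * coeff 0 s) :
    coeff 2 ((List.ofFn G).prod 1) = ∑ j, (∏ l, if l = j then 1 else b l) • Q j
      + ∑ i, ∑ j, if i < j then (∏ l, if l = i ∨ l = j then 1 else b l) • (P' i * P j) else 0 := by
  induction k with
  | zero => simp [coeff_one]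
  | succ k ih =>
    rw [List.ofFn_succ, List.prod_cons, Module.End.mul_apply, h2,
      ih (fun j => b j.succ) (fun j => P j.succ) (fun j => P' j.succ) (fun j => Q j.succ)
        (fun j => G j.succ) (fun j => h0 j.succ) (fun j => h1 j.succ) (fun j => h2 j.succ),
      coeff_one_prod_ofFn (fun j => b j.succ) (fun j => P j.succ) (fun j => G j.succ)
        (fun j => h0 j.succ) (fun j => h1 j.succ),
      coeff_zero_prod_ofFn (fun j => b j.succ) (fun j => G j.succ) (fun j => h0 j.succ)]
    simp only [Fin.sum_univ_succ, Fin.prod_univ_succ, Fin.succ_ne_zero, Fin.succ_inj,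
      (Fin.succ_ne_zero _).symm, if_true, if_false, mul_smul, Finset.smul_sum, one_smul,
      mul_smul_comm, mul_one, Fin.succ_lt_succ_iff, Fin.succ_pos, Fin.not_lt_zero, 
      zero_add, Finset.mul_sum, or_true, false_or, smul_add, smul_ite, smul_zero,
      or_false]
    abel

end Expansion

/-! ### Which permutations survive at each order. -/

section Collapse

variable {N k : ℕ} {S : Type*} [AddCommGroup S] [Module ℂ S]

theorem sum_sign_prod_all {p : Fin k → Fin N} (hp : Function.Injective p)
    (f : Equiv.Perm (Fin k) → S) :
    ∑ σ : Equiv.Perm (Fin k), ((Equiv.Perm.sign σ : ℤ) : ℂ) •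
      ((∏ l, if p l = p (σ l) then (1 : ℂ) else 0) • f σ) = f 1 := by
  rw [Finset.sum_eq_single 1]
  · simp
  · intro σ _ hσ
    rw [Finset.prod_ite_zero, if_neg, zero_smul, smul_zero]
    exact fun h => hσ (Equiv.ext fun l => (hp (h l (Finset.mem_univ l))).symm)
  · simp

theorem sum_sign_prod_off_one {p : Fin k → Fin N} (hp : Function.Injective p) (i : Fin k)
    (f : Equiv.Perm (Fin k) → S) :
    ∑ σ : Equiv.Perm (Fin k), ((Equiv.Perm.sign σ : ℤ) : ℂ) •
      ((∏ l, if l = i then (1 : ℂ) else if p l = p (σ l) then 1 else 0) • f σ) = f 1 := by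
  rw [Finset.sum_eq_single 1]
  · simp
  · intro σ _ hσ
    simp only [← ite_or, hp.eq_iff]
    rw [Finset.prod_ite_zero, if_neg, zero_smul, smul_zero]
    intro h
    have h' : ∀ l, l = i ∨ l = i ∨ σ l = l := fun l =>
      Or.inr ((h l (Finset.mem_univ l)).imp_right Eq.symm)
    rcases (perm_fix_off_pair σ).1 h' with h | h
    · exact hσ h
    · exact hσ (by rw [h, Equiv.swap_self]; rfl)
  · simp

/-- For injective `p` the Kronecker factors force `σ` to fix everything except `i` and `j`; the sign
of the transposition then produces a 2×2 minor. -/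
theorem sum_sign_prod_off_pair {p : Fin k → Fin N} (hp : Function.Injective p) {i j : Fin k}
    (hij : i ≠ j) (f : Equiv.Perm (Fin k) → S) :
    ∑ σ : Equiv.Perm (Fin k), ((Equiv.Perm.sign σ : ℤ) : ℂ) •
      ((∏ l, if l = i ∨ l = j then (1 : ℂ) else if p l = p (σ l) then 1 else 0) • f σ)
      = f 1 - f (Equiv.swap i j) := by
  have hne : (1 : Equiv.Perm (Fin k)) ≠ Equiv.swap i j := fun h => hij (by
    have := congrArg (fun τ : Equiv.Perm (Fin k) => τ i) h
    simpa using this)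
  have hv : ∀ σ : Equiv.Perm (Fin k),
      (∏ l, if l = i ∨ l = j then (1 : ℂ) else if p l = p (σ l) then 1 else 0)
        = if σ = 1 ∨ σ = Equiv.swap i j then 1 else 0 := by
    intro σ
    simp only [← ite_or, hp.eq_iff]
    rw [Finset.prod_ite_zero, Finset.prod_const_one]
    have hiff : (∀ l ∈ Finset.univ, (l = i ∨ l = j) ∨ l = σ l) ↔ σ = 1 ∨ σ = Equiv.swap i j := by
      rw [← perm_fix_off_pair]
      simp only [Finset.mem_univ, true_imp_iff, or_assoc, eq_comm (b := σ _)]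
    by_cases h : σ = 1 ∨ σ = Equiv.swap i j
    · rw [if_pos h, if_pos (hiff.2 h)]
    · rw [if_neg h, if_neg (fun h' => h (hiff.1 h'))]
  rw [← Finset.sum_subset (Finset.subset_univ {1, Equiv.swap i j}), Finset.sum_pair hne]
  · simp [hv, Equiv.Perm.sign_swap hij, sub_eq_add_neg]
  · intro σ _ hσ
    rw [hv, if_neg, zero_smul, smul_zero]
    simpa using hσ

end Collapse

/-! ### From injective index tuples to subsets. -/

section Injections

variable {N k : ℕ} {S : Type*} [AddCommGroup S] [Module ℂ S]

theorem sum_injective_image (F : Finset (Fin N) → S) :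
    ∑ p : Fin k → Fin N, (if Function.Injective p then F (Finset.univ.image p) else 0)
      = (k.factorial : ℂ) • ∑ s ∈ Finset.powersetCard k Finset.univ, F s := by
  rw [← Finset.sum_filter, Finset.smul_sum]
  rw [← Finset.sum_fiberwise_of_maps_to (t := Finset.powersetCard k Finset.univ)
    (g := fun p => Finset.univ.image p)]
  · refine Finset.sum_congr rfl fun s hs => ?_
    have hs' := (Finset.mem_powersetCard.1 hs).2
    rw [Finset.sum_congr rfl (g := fun _ => F s)
      (fun p hp => by rw [(Finset.mem_filter.1 hp).2]), Finset.sum_const, Nat.cast_smul_eq_nsmul]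
    congr 1
    -- The injections with image `s` are the bijections `Fin k ≃ s`.
    have e0 : Fintype.card (Fin k ≃ s) = k.factorial := by
      rw [Fintype.card_equiv (s.equivFinOfCardEq hs').symm, Fintype.card_fin]
    rw [← e0, ← Finset.card_univ]
    symm
    refine Finset.card_bij (fun τ _ l => (τ l : Fin N)) ?_ ?_ ?_
    · intro τ _
      simp only [Finset.mem_filter, Finset.mem_univ, true_and]
      refine ⟨fun a b h => τ.injective (Subtype.ext h), ?_⟩
      ext a
      simp only [Finset.mem_image, Finset.mem_univ, true_and]
      constructor
      · rintro ⟨l, rfl⟩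
        exact (τ l).2
      · intro ha
        exact ⟨τ.symm ⟨a, ha⟩, by simp⟩
    · intro τ _ τ' _ h
      ext l
      exact congrArg Fin.val (congrFun h l)
    · intro p hp
      simp only [Finset.mem_filter, Finset.mem_univ, true_and] at hp
      obtain ⟨hp, rfl⟩ := hp
      refine ⟨Equiv.ofBijective (fun l => ⟨p l, Finset.mem_image_of_mem p (Finset.mem_univ l)⟩)
        ⟨fun a b h => hp (Subtype.ext_iff.1 h), ?_⟩, Finset.mem_univ _, rfl⟩
      rintro ⟨a, ha⟩
      obtain ⟨l, _, rfl⟩ := Finset.mem_image.1 ha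
      exact ⟨l, rfl⟩
  · intro p hp
    rw [Finset.mem_powersetCard]
    refine ⟨Finset.subset_univ _, ?_⟩
    rw [Finset.card_image_of_injective _ (Finset.mem_filter.1 hp).2, Finset.card_univ,
      Fintype.card_fin]

/-- Reversing the tuple preserves injectivity and the weight, and exchanges `i < j` with `j < i`. -/
theorem sum_lt_pair_symm (κ : Fin N → ℂ) (H : Fin N → Fin N → S) :
    ∑ p : Fin k → Fin N, (if Function.Injective p then
        (∏ l, κ (p l)) • ∑ i, ∑ j, (if i < j then H (p i) (p j) else 0) else 0)
      = ∑ p : Fin k → Fin N, (if Function.Injective p then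
        (∏ l, κ (p l)) • ∑ i, ∑ j, (if j < i then H (p i) (p j) else 0) else 0) := by
  refine Fintype.sum_equiv (Equiv.arrowCongr Fin.revPerm (Equiv.refl _)) _ _ fun p => ?_
  have hc : ((Equiv.arrowCongr Fin.revPerm (Equiv.refl _)) p : Fin k → Fin N) = p ∘ Fin.revPerm :=
    rfl
  rw [hc]
  refine if_congr (Equiv.injective_comp _ p).symm ?_ rfl
  congr 1
  · exact Fintype.prod_equiv Fin.revPerm _ _ fun l => by simp
  · refine Fintype.sum_equiv Fin.revPerm _ _ fun i => ?_
    refine Fintype.sum_equiv Fin.revPerm _ _ fun j => ?_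
    simp

/-- `H` need not be symmetric, so for one tuple the sum over `i < j` depends on the ordering. Only
after summing over all tuples can it be replaced by half the sum over ordered pairs, which depends
on the image alone. -/
theorem sum_lt_pair (κ : Fin N → ℂ) (H : Fin N → Fin N → S) :
    ∑ p : Fin k → Fin N, (if Function.Injective p then
        (∏ l, κ (p l)) • ∑ i, ∑ j, (if i < j then H (p i) (p j) else 0) else 0)
      = ∑ p : Fin k → Fin N, (if Function.Injective p then
        (∏ a ∈ Finset.univ.image p, κ a) •
          (1 / 2 : ℂ) • ∑ a ∈ Finset.univ.image p, ∑ b ∈ (Finset.univ.image p).erase a, H a b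
          else 0) := by
  have h2 : ∀ s t : S, s = t → s = (1 / 2 : ℂ) • (s + t) := by
    rintro s _ rfl
    rw [← two_smul ℂ s, smul_smul]
    norm_num
  rw [h2 _ _ (sum_lt_pair_symm κ H), ← Finset.sum_add_distrib, Finset.smul_sum]
  refine Finset.sum_congr rfl fun p _ => ?_
  split_ifs with hp
  · rw [← smul_add, Finset.prod_image (fun a _ b _ h => hp h), smul_comm,
      Finset.sum_image (fun a _ b _ h => hp h)]
    congr 2
    rw [← Finset.sum_add_distrib]
    refine Finset.sum_congr rfl fun i _ => ?_
    rw [← Finset.image_erase hp, Finset.sum_image (fun a _ b _ h => hp h),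
      ← Finset.sum_add_distrib, ← Finset.filter_ne' , Finset.sum_filter]
    refine Finset.sum_congr rfl fun j _ => ?_
    rcases lt_trichotomy i j with h | h | h
    · simp [h, h.ne', h.not_gt]
    · simp [h]
    · simp [h, h.ne, h.not_gt]
  · simp

end Injections

/-! ### Low-order coefficients of the alternating trace. -/

section AntisymTrace

open PowerSeries

variable {N k : ℕ} {R : Type*} [Ring R] [Algebra ℂ R]

theorem coeff_smul_complex (m : ℕ) (c : ℂ) (f : PowerSeries R) :
    coeff m (c • f) = c • coeff m f := rfl

/-- `∑_p κ_p ∑_σ sign(σ) ∏_j G_j(p_j, p_{σ j})` over `k!`, applied to `1`. -/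
noncomputable def altSum (κ : Fin N → ℂ)
    (G : Fin k → Fin N → Fin N → Module.End ℂ (PowerSeries R)) : PowerSeries R :=
  (k.factorial : ℂ)⁻¹ • ∑ p : Fin k → Fin N, (∏ l, κ (p l)) •
    ∑ σ : Equiv.Perm (Fin k), ((Equiv.Perm.sign σ : ℤ) : ℂ) •
      (List.ofFn fun j => G j (p j) (p (σ j))).prod 1

theorem coeff_altSum (κ : Fin N → ℂ)
    (G : Fin k → Fin N → Fin N → Module.End ℂ (PowerSeries R)) (m : ℕ)
    (F : (Fin k → Fin N) → R)
    (hF : ∀ p, Function.Injective p → ∑ σ : Equiv.Perm (Fin k), ((Equiv.Perm.sign σ : ℤ) : ℂ) •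
      coeff m ((List.ofFn fun j => G j (p j) (p (σ j))).prod 1) = F p) :
    coeff m (altSum κ G) = (k.factorial : ℂ)⁻¹ • ∑ p : Fin k → Fin N,
      if Function.Injective p then (∏ l, κ (p l)) • F p else 0 := by
  simp only [altSum, coeff_smul_complex, map_sum]
  congr 1
  refine Finset.sum_congr rfl fun p _ => ?_
  split_ifs with hp
  · rw [hF p hp]
  · have h := sum_sign_smul_eq_zero p hp
      (fun r => coeff m ((List.ofFn fun j => G j (p j) (r j)).prod 1))
    simp only [Function.comp_apply] at h
    rw [h, smul_zero]

theorem inv_factorial_smul_sum_injective {S : Type*} [AddCommGroup S] [Module ℂ S]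
    (F : Finset (Fin N) → S) :
    (k.factorial : ℂ)⁻¹ • ∑ p : Fin k → Fin N,
        (if Function.Injective p then F (Finset.univ.image p) else 0)
      = ∑ s ∈ Finset.powersetCard k Finset.univ, F s := by
  rw [sum_injective_image, inv_smul_smul₀]
  exact_mod_cast k.factorial_ne_zero

variable (κ : Fin N → ℂ) (P P' : Fin N → Fin N → R) (Q : Fin k → Fin N → Fin N → R)
  (q t : Fin N → R) (G : Fin k → Fin N → Fin N → Module.End ℂ (PowerSeries R))

theorem coeff_zero_altSum
    (h0 : ∀ j a b s, coeff 0 (G j a b s) = (if a = b then (1 : ℂ) else 0) • coeff 0 s) :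
    coeff 0 (altSum κ G) = ∑ s ∈ Finset.powersetCard k Finset.univ, (∏ a ∈ s, κ a) • (1 : R) := by
  rw [coeff_altSum κ G 0 (fun _ => 1), ← inv_factorial_smul_sum_injective]
  · congr 1
    refine Finset.sum_congr rfl fun p _ => ?_
    split_ifs with hp
    · rw [Finset.prod_image (fun a _ b _ h => hp h)]
    · rfl
  · intro p hp
    simp only [fun σ : Equiv.Perm (Fin k) => coeff_zero_prod_ofFn _
      (fun j => G j (p j) (p (σ j))) (fun j s => h0 j (p j) (p (σ j)) s)]
    rw [sum_sign_prod_all hp]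

theorem coeff_one_altSum
    (h0 : ∀ j a b s, coeff 0 (G j a b s) = (if a = b then (1 : ℂ) else 0) • coeff 0 s)
    (h1 : ∀ j a b s, coeff 1 (G j a b s)
      = (if a = b then (1 : ℂ) else 0) • coeff 1 s + P a b * coeff 0 s) :
    coeff 1 (altSum κ G) = ∑ s ∈ Finset.powersetCard k Finset.univ,
      (∏ a ∈ s, κ a) • ∑ a ∈ s, P a a := by
  rw [coeff_altSum κ G 1 (fun p => ∑ j, P (p j) (p j)), ← inv_factorial_smul_sum_injective]
  · congr 1
    refine Finset.sum_congr rfl fun p _ => ?_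
    split_ifs with hp
    · rw [Finset.prod_image (fun a _ b _ h => hp h), Finset.sum_image (fun a _ b _ h => hp h)]
    · rfl
  · intro p hp
    simp only [fun σ : Equiv.Perm (Fin k) => coeff_one_prod_ofFn _ _
      (fun j => G j (p j) (p (σ j))) (fun j s => h0 j (p j) (p (σ j)) s)
      (fun j s => h1 j (p j) (p (σ j)) s), Finset.smul_sum]
    rw [Finset.sum_comm]
    refine Finset.sum_congr rfl fun j _ => ?_
    rw [sum_sign_prod_off_one hp j (fun σ => P (p j) (p (σ j)))]
    rfl

/-- The term `j • t` allows the operator to depend on its position, as the shifts `u - j` of the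
Yangian series require. -/
theorem coeff_two_altSum
    (hQ : ∀ j a, Q j a a = q a + ((j : ℕ) : ℂ) • t a)
    (h0 : ∀ j a b s, coeff 0 (G j a b s) = (if a = b then (1 : ℂ) else 0) • coeff 0 s)
    (h1 : ∀ j a b s, coeff 1 (G j a b s)
      = (if a = b then (1 : ℂ) else 0) • coeff 1 s + P a b * coeff 0 s)
    (h2 : ∀ j a b s, coeff 2 (G j a b s)
      = (if a = b then (1 : ℂ) else 0) • coeff 2 s + P' a b * coeff 1 s + Q j a b * coeff 0 s) :
    coeff 2 (altSum κ G) = ∑ s ∈ Finset.powersetCard k Finset.univ,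
      (∏ a ∈ s, κ a) • (∑ a ∈ s, q a + (1 / 2 : ℂ) • ∑ a ∈ s, ∑ b ∈ s.erase a,
        (P' a a * P b b - P' a b * P b a + t b)) := by
  -- The weight `j` counts the positions `i < j`, which turns the position-dependent term into a
  -- pair term that can be symmetrized with the minors.
  have hcount : ∀ p : Fin k → Fin N, ∑ j : Fin k, ((j : ℕ) : ℂ) • t (p j)
      = ∑ i : Fin k, ∑ j : Fin k, if i < j then t (p j) else 0 := by
    intro p
    rw [Finset.sum_comm]
    refine Finset.sum_congr rfl fun j _ => ?_
    rw [← Finset.sum_filter, Finset.sum_const, Nat.cast_smul_eq_nsmul]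
    congr 1
    rw [show (Finset.univ.filter fun i => i < j) = Finset.Iio j by ext; simp, Fin.card_Iio]
  rw [coeff_altSum κ G 2 (fun p => ∑ j, q (p j) + ∑ i, ∑ j, if i < j then
      P' (p i) (p i) * P (p j) (p j) - P' (p i) (p j) * P (p j) (p i) + t (p j) else 0)]
  · have := sum_lt_pair (k := k) κ (fun a b => P' a a * P b b - P' a b * P b a + t b)
    have hsplit : ∀ (c : (Fin k → Fin N) → ℂ) (f g : (Fin k → Fin N) → R),
        ∑ p : Fin k → Fin N, (if Function.Injective p then c p • (f p + g p) else 0)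
        = ∑ p : Fin k → Fin N, (if Function.Injective p then c p • f p else 0)
          + ∑ p : Fin k → Fin N, (if Function.Injective p then c p • g p else 0) := by
      intro c f g
      rw [← Finset.sum_add_distrib]
      refine Finset.sum_congr rfl fun p _ => ?_
      split_ifs <;> simp
    rw [hsplit, this, ← Finset.sum_add_distrib, ← inv_factorial_smul_sum_injective]
    congr 1
    refine Finset.sum_congr rfl fun p _ => ?_
    split_ifs with hp
    · rw [Finset.prod_image (fun a _ b _ h => hp h), smul_add]
      congr 2
      rw [Finset.sum_image (fun a _ b _ h => hp h)]
    · simp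
  · intro p hp
    simp only [fun σ : Equiv.Perm (Fin k) => coeff_two_prod_ofFn _ _ _ _
      (fun j => G j (p j) (p (σ j))) (fun j s => h0 j (p j) (p (σ j)) s)
      (fun j s => h1 j (p j) (p (σ j)) s) (fun j s => h2 j (p j) (p (σ j)) s),
      smul_add, Finset.sum_add_distrib]
    have e1 : ∑ σ : Equiv.Perm (Fin k), ((Equiv.Perm.sign σ : ℤ) : ℂ) • ∑ j,
        (∏ l, if l = j then (1 : ℂ) else if p l = p (σ l) then 1 else 0) • Q j (p j) (p (σ j))
        = ∑ j, Q j (p j) (p j) := by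
      simp only [Finset.smul_sum]
      rw [Finset.sum_comm]
      refine Finset.sum_congr rfl fun j _ => ?_
      rw [sum_sign_prod_off_one hp j (fun σ => Q j (p j) (p (σ j)))]
      rfl
    have e2 : ∑ σ : Equiv.Perm (Fin k), ((Equiv.Perm.sign σ : ℤ) : ℂ) • ∑ i, ∑ j,
        (if i < j then (∏ l, if l = i ∨ l = j then (1 : ℂ) else if p l = p (σ l) then 1 else 0) •
          (P' (p i) (p (σ i)) * P (p j) (p (σ j))) else 0)
        = ∑ i, ∑ j, if i < j then
          P' (p i) (p i) * P (p j) (p j) - P' (p i) (p j) * P (p j) (p i) else 0 := by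
      simp only [Finset.smul_sum]
      rw [Finset.sum_comm]
      refine Finset.sum_congr rfl fun i _ => ?_
      rw [Finset.sum_comm]
      refine Finset.sum_congr rfl fun j _ => ?_
      split_ifs with hij
      · rw [sum_sign_prod_off_pair hp hij.ne
          (fun σ => P' (p i) (p (σ i)) * P (p j) (p (σ j)))]
        simp
      · simp
    rw [e1, e2]
    simp only [hQ, Finset.sum_add_distrib, hcount]
    rw [add_assoc]
    congr 1
    simp only [← Finset.sum_add_distrib]
    refine Finset.sum_congr rfl fun i _ => Finset.sum_congr rfl fun j _ => ?_
    split_ifs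
    · abel
    · simp

end AntisymTrace

/-! ### Generating sums over subsets, and partial fractions. -/

section SubsetSums

variable {N : ℕ} {S : Type*} [AddCommGroup S] [Module ℂ S]

/-- The weight `∏_{a ∈ s} (-K_a) ∏_{a ∉ s} x`. -/
noncomputable def subsetWeight (K : Fin N → ℂ) (x : ℂ) (s : Finset (Fin N)) : ℂ :=
  (-1) ^ s.card * x ^ (N - s.card) * ∏ a ∈ s, K a

/-- Expand `∏ (-K_a + x)`, with `x` replaced by `0` for `a ∈ A`, over the set `s` of indices where
`-K_a` is chosen: any `s` missing a point of `A` picks up a zero factor. -/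
theorem sum_subsetWeight_superset (K : Fin N → ℂ) {x : ℂ} (hx : ∀ a, x ≠ K a)
    (A : Finset (Fin N)) :
    ∑ s : Finset (Fin N), (if A ⊆ s then subsetWeight K x s else 0)
      = (∏ a ∈ A, -K a / (x - K a)) * ∏ a, (x - K a) := by
  have h1 : (∏ a ∈ A, -K a / (x - K a)) * ∏ a, (x - K a)
      = ∏ a, (-K a + if a ∈ A then 0 else x) := by
    rw [Finset.prod_congr rfl (g := fun a => if a ∈ A then -K a / (x - K a) else 1)
        (fun a ha => (if_pos ha).symm),
      Finset.prod_subset (Finset.subset_univ A) (fun a _ ha => if_neg ha),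
      ← Finset.prod_mul_distrib]
    refine Finset.prod_congr rfl fun a _ => ?_
    have := sub_ne_zero.2 (hx a)
    split_ifs
    · field_simp
      simp
    · ring
  rw [h1, Finset.prod_add, Finset.powerset_univ]
  refine Finset.sum_congr rfl fun s _ => ?_
  split_ifs with h
  · rw [Finset.prod_neg, Finset.prod_congr (s₁ := Finset.univ \ s) rfl (g := fun _ => x),
      Finset.prod_const,
      Finset.card_sdiff_of_subset (Finset.subset_univ s), Finset.card_univ, Fintype.card_fin,
      subsetWeight]
    · ring
    · intro a ha
      rw [if_neg fun h' => (Finset.mem_sdiff.1 ha).2 (h h')]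
  · obtain ⟨a, ha, has⟩ := Finset.not_subset.1 h
    rw [Finset.prod_eq_zero (i := a) (s := Finset.univ \ s), mul_zero]
    · simp [has]
    · rw [if_pos ha]

theorem sum_powersetCard_subsetWeight (K : Fin N → ℂ) (x : ℂ) (Φ : Finset (Fin N) → S) :
    ∑ k ∈ Finset.range (N + 1), ((-1) ^ k * x ^ (N - k)) •
        ∑ s ∈ Finset.powersetCard k Finset.univ, (∏ a ∈ s, K a) • Φ s
      = ∑ s, subsetWeight K x s • Φ s := by
  rw [← Finset.powerset_univ, Finset.sum_powerset, Finset.card_univ, Fintype.card_fin]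
  refine Finset.sum_congr rfl fun k _ => ?_
  rw [Finset.smul_sum]
  refine Finset.sum_congr rfl fun s hs => ?_
  rw [subsetWeight, (Finset.mem_powersetCard.1 hs).2, smul_smul]

theorem sum_subsetWeight_smul_const (K : Fin N → ℂ) {x : ℂ} (hx : ∀ a, x ≠ K a) (c : S) :
    ∑ s, subsetWeight K x s • c = (∏ a, (x - K a)) • c := by
  have := sum_subsetWeight_superset K hx ∅
  simp only [Finset.empty_subset, if_true, Finset.prod_empty, one_mul] at this
  rw [← Finset.sum_smul, this]

theorem sum_subsetWeight_smul_sum (K : Fin N → ℂ) {x : ℂ} (hx : ∀ a, x ≠ K a) (f : Fin N → S) :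
    ∑ s, subsetWeight K x s • ∑ a ∈ s, f a
      = (∏ a, (x - K a)) • ∑ a, (-K a / (x - K a)) • f a := by
  have h : ∀ s : Finset (Fin N), subsetWeight K x s • ∑ a ∈ s, f a
      = ∑ a, (if {a} ⊆ s then subsetWeight K x s else 0) • f a := by
    intro s
    rw [Finset.smul_sum, ← Finset.sum_subset (Finset.subset_univ s)]
    · exact Finset.sum_congr rfl fun a ha => by rw [if_pos (by simpa using ha)]
    · intro a _ ha
      rw [if_neg (by simpa using ha), zero_smul]
  simp only [h]
  rw [Finset.sum_comm, Finset.smul_sum]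
  refine Finset.sum_congr rfl fun a _ => ?_
  rw [← Finset.sum_smul, sum_subsetWeight_superset K hx, Finset.prod_singleton, mul_comm, mul_smul]

theorem sum_subsetWeight_smul_sum_pair (K : Fin N → ℂ) {x : ℂ} (hx : ∀ a, x ≠ K a)
    (f : Fin N → Fin N → S) :
    ∑ s, subsetWeight K x s • ∑ a ∈ s, ∑ b ∈ s.erase a, f a b
      = (∏ a, (x - K a)) • ∑ a, ∑ b ∈ Finset.univ.erase a,
          (K a * K b / ((x - K a) * (x - K b))) • f a b := by
  have h : ∀ s : Finset (Fin N), subsetWeight K x s • ∑ a ∈ s, ∑ b ∈ s.erase a, f a b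
      = ∑ a, ∑ b ∈ Finset.univ.erase a, (if {a, b} ⊆ s then subsetWeight K x s else 0) • f a b := by
    intro s
    rw [Finset.smul_sum, ← Finset.sum_subset (Finset.subset_univ s)]
    · refine Finset.sum_congr rfl fun a ha => ?_
      rw [Finset.smul_sum, ← Finset.sum_subset
        (Finset.erase_subset_erase a (Finset.subset_univ s))]
      · refine Finset.sum_congr rfl fun b hb => ?_
        rw [if_pos]
        simp [Finset.insert_subset_iff, ha, Finset.mem_of_mem_erase hb]
      · intro b hb hb'
        rw [if_neg, zero_smul]
        intro h
        exact hb' (Finset.mem_erase.2 ⟨Finset.ne_of_mem_erase hb, h (by simp)⟩)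
    · intro a _ ha
      refine Finset.sum_eq_zero fun b _ => ?_
      rw [if_neg, zero_smul]
      exact fun h => ha (h (by simp))
  simp only [h]
  rw [Finset.sum_comm, Finset.smul_sum]
  refine Finset.sum_congr rfl fun a _ => ?_
  rw [Finset.sum_comm, Finset.smul_sum]
  refine Finset.sum_congr rfl fun b hb => ?_
  rw [← Finset.sum_smul, sum_subsetWeight_superset K hx,
    Finset.prod_pair (Finset.ne_of_mem_erase hb).symm, mul_comm, mul_smul, div_mul_div_comm,
    neg_mul_neg]

/-- Partial fractions for a symmetric family. -/
theorem sum_pair_partial_fractions {K : Fin N → ℂ} (hK : Function.Injective K) {x : ℂ}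
    (hx : ∀ a, x ≠ K a) (c : Fin N → Fin N → ℂ) (hc : ∀ a b, c a b = c b a)
    (f : Fin N → Fin N → S) (hf : ∀ a b, f a b = f b a) :
    ∑ a, ∑ b ∈ Finset.univ.erase a, (c a b / (K a - K b) / (x - K a)) • f a b
      = (1 / 2 : ℂ) • ∑ a, ∑ b ∈ Finset.univ.erase a,
          (c a b / ((x - K a) * (x - K b))) • f a b := by
  -- Averaging the sum with its image under `a ↔ b` allows the use of `1/(x - K_a) - 1/(x - K_b) =
  -- (K_a - K_b)/((x - K_a)(x - K_b))`.
  have hswap : ∑ a, ∑ b ∈ Finset.univ.erase a, (c a b / (K a - K b) / (x - K a)) • f a b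
      = ∑ a, ∑ b ∈ Finset.univ.erase a, (c a b / (K b - K a) / (x - K b)) • f a b := by
    rw [Finset.sum_comm' (t' := Finset.univ) (s' := fun b => Finset.univ.erase b)
      (by simp [eq_comm])]
    refine Finset.sum_congr rfl fun a _ => Finset.sum_congr rfl fun b _ => ?_
    rw [hc, hf]
  have h2 : ∀ s t u : S, s = t → s + t = u → s = (1 / 2 : ℂ) • u := by
    rintro s _ _ rfl rfl
    rw [← two_smul ℂ s, smul_smul]
    norm_num
  refine h2 _ _ _ hswap ?_
  rw [← Finset.sum_add_distrib]
  refine Finset.sum_congr rfl fun a _ => ?_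
  rw [← Finset.sum_add_distrib]
  refine Finset.sum_congr rfl fun b hb => ?_
  rw [← add_smul]
  congr 1
  have h1 := sub_ne_zero.2 (hx a)
  have h2 := sub_ne_zero.2 (hx b)
  have h3 := sub_ne_zero.2 (fun h => Finset.ne_of_mem_erase hb (hK h).symm : K a ≠ K b)
  have h4 : K b - K a ≠ 0 := fun h => h3 (by rw [← neg_sub, h, neg_zero])
  rw [← neg_sub (K a) (K b)]
  field_simp
  ring

end SubsetSums

/-! ### Matrix products of legs, and the shift of `u`. -/

section LegProduct

open PowerSeries

variable {N k : ℕ} {R : Type*} [Ring R] [Algebra ℂ R]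

/-- Row `p` of a leg is supported on the columns obtained from `p` by changing its `l`-th entry. -/
theorem leg_mul (l : Fin k) (F : Matrix (Fin N) (Fin N) R)
    (Z : Matrix (Fin k → Fin N) (Fin k → Fin N) R) :
    leg l F * Z = legAct l (fun a b => LinearMap.mulLeft ℂ (F a b)) Z := by
  ext p q
  simp only [Matrix.mul_apply, leg, legAct, Matrix.of_apply, LinearMap.mulLeft_apply]
  symm
  refine Finset.sum_of_injOn (fun b => Function.update p l b) ?_ (by simp) ?_ ?_
  · intro a _ b _ h
    simpa using congrFun h l
  · intro r _ hr
    rw [if_neg, zero_mul]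
    intro h
    refine hr ⟨r l, by simp, ?_⟩
    funext j
    by_cases hj : j = l
    · subst hj
      simp
    · simp [hj, h j hj]
  · intro b _
    rw [if_pos]
    · simp
    · intro j hj
      simp [hj]

theorem list_prod_map_mul {ι A : Type*} [Monoid A] (f : ι → A) (ls : List ι) (Z : A) :
    (ls.map f).prod * Z = ls.foldr (fun j => (f j * ·)) Z := by
  induction ls with
  | nil => simp
  | cons j ls ih => simp [mul_assoc, ih]

theorem trace_prod_leg_antisym (κ : Fin N → ℂ) (π : Equiv.Perm (Fin k))
    (F : Fin k → Matrix (Fin N) (Fin N) (PowerSeries R)) :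
    Matrix.trace (scalarMat (tensorPow k (Matrix.diagonal κ))
        * (List.ofFn fun j => leg (π j) (F j)).prod * scalarMat (antisym N k))
      = altSum κ fun j a b => LinearMap.mulLeft ℂ (F j a b) := by
  refine Eq.trans ?_ (sum_foldr_legAct_antisym π
    (fun j a b => LinearMap.mulLeft ℂ (F j a b)) (1 : PowerSeries R) κ)
  rw [mul_assoc, List.ofFn_eq_map, list_prod_map_mul]
  simp only [leg_mul]
  rw [Matrix.trace]
  refine Finset.sum_congr rfl fun p _ => ?_
  -- The tensor power of a diagonal matrix is diagonal, so it enters the trace only as the weight of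
  -- `p`.
  rw [Matrix.diag_apply, Matrix.mul_apply, Finset.sum_eq_single p]
  · have hA : (scalarMat (antisym N k) : Matrix _ _ (PowerSeries R))
        = Matrix.of fun r q => antisym N k r q • (1 : PowerSeries R) := by
      ext1 r q
      simp [scalarMat, Algebra.algebraMap_eq_smul_one]
    rw [hA, Algebra.smul_def]
    simp [scalarMat, tensorPow]
  · intro r _ hr
    have : ∃ l, p l ≠ r l := by
      by_contra! h
      exact hr (funext fun l => (h l).symm)
    obtain ⟨l, hl⟩ := this
    simp only [scalarMat, tensorPow, Matrix.map_apply, Matrix.of_apply]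
    have h0 : ∏ i, Matrix.diagonal κ (p i) (r i) = 0 :=
      Finset.prod_eq_zero (Finset.mem_univ l) (Matrix.diagonal_apply_ne κ hl)
    rw [h0, map_zero, zero_mul]
  · simp

theorem coeff_two_mul {R : Type*} [Ring R] (f g : PowerSeries R) :
    coeff 2 (f * g) = coeff 0 f * coeff 2 g + coeff 1 f * coeff 1 g + coeff 2 f * coeff 0 g := by
  rw [coeff_mul, Finset.Nat.sum_antidiagonal_eq_sum_range_succ_mk]
  simp [Finset.sum_range_succ]

theorem coeff_zero_mul' {R : Type*} [Ring R] (f g : PowerSeries R) :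
    coeff 0 (f * g) = coeff 0 f * coeff 0 g := by
  simp

theorem coeff_one_mul' {R : Type*} [Ring R] (f g : PowerSeries R) :
    coeff 1 (f * g) = coeff 0 f * coeff 1 g + coeff 1 f * coeff 0 g := by
  rw [coeff_mul, Finset.Nat.sum_antidiagonal_eq_sum_range_succ_mk]
  simp [Finset.sum_range_succ]

theorem coeff_zero_shiftU (c : ℂ) (f : PowerSeries R) : coeff 0 (shiftU c f) = coeff 0 f := by
  simp [shiftU]

theorem coeff_one_shiftU (c : ℂ) (f : PowerSeries R) : coeff 1 (shiftU c f) = coeff 1 f := by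
  simp [shiftU, Finset.sum_range_succ, invShift, coeff_one]

/-- `(u - c)⁻¹ = u⁻¹ + c u⁻² + ⋯`, and `(u - c)⁻²` starts with `u⁻²`. -/
theorem coeff_two_shiftU (c : ℂ) (f : PowerSeries R) :
    coeff 2 (shiftU c f) = coeff 2 f + c • coeff 1 f := by
  simp [shiftU, Finset.sum_range_succ, invShift, coeff_one, coeff_two_mul, sq]
  rw [add_comm]

end LegProduct

/-! ### The XXX generating sum in the Yangian. -/

section XXX

open PowerSeries

variable {N : ℕ}

/-- The series shifted by `j` sits in factor `j.rev`; this reversal is the permutation absorbed by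
the trace formula. -/
theorem xxxTransfer_diagonal (k : ℕ) (K : Fin N → ℂ) :
    xxxTransfer k (Matrix.diagonal K) = altSum K fun (j : Fin k) a b =>
      LinearMap.mulLeft ℂ (shiftU ((j : ℕ) : ℂ) (serT N a b)) :=
  trace_prod_leg_antisym K Fin.revPerm fun j => (serT N).map (shiftU ((j : ℕ) : ℂ))

/-- The sum `∑_k (-1)ᵏ x^{N-k} T_{k,K}(u)` in the Yangian. -/
noncomputable def xxxSum (K : Fin N → ℂ) (x : ℂ) : PowerSeries (Yangian N) :=
  ∑ k ∈ Finset.range (N + 1), ((-1) ^ k * x ^ (N - k)) • xxxTransfer k (Matrix.diagonal K)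

theorem coeff_zero_serT (a b : Fin N) :
    coeff 0 (serT N a b) = if a = b then (1 : Yangian N) else 0 := by
  simp only [serT, Matrix.of_apply, coeff_mk]
  exact (Yangian.isYangianFamily_T N).zero a b

theorem coeff_serT (a b : Fin N) (s : ℕ) : coeff s (serT N a b) = Yangian.T a b s := by
  simp [serT]

theorem coeff_zero_xxxSum (K : Fin N → ℂ) {x : ℂ} (hx : ∀ a, x ≠ K a) :
    coeff 0 (xxxSum K x) = (∏ a, (x - K a)) • (1 : Yangian N) := by
  rw [← sum_subsetWeight_smul_const K hx, ← sum_powersetCard_subsetWeight, xxxSum, map_sum]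
  refine Finset.sum_congr rfl fun k _ => ?_
  rw [coeff_smul_complex, xxxTransfer_diagonal, coeff_zero_altSum]
  intro j a b s
  rw [LinearMap.mulLeft_apply, coeff_zero_mul', coeff_zero_shiftU, coeff_zero_serT]
  split_ifs <;> simp

theorem coeff_one_xxxSum (K : Fin N → ℂ) {x : ℂ} (hx : ∀ a, x ≠ K a) :
    coeff 1 (xxxSum K x)
      = (∏ a, (x - K a)) • ∑ a, (-K a / (x - K a)) • (Yangian.T a a 1 : Yangian N) := by
  rw [← sum_subsetWeight_smul_sum K hx, ← sum_powersetCard_subsetWeight, xxxSum, map_sum]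
  refine Finset.sum_congr rfl fun k _ => ?_
  rw [coeff_smul_complex, xxxTransfer_diagonal, coeff_one_altSum K (fun a b => Yangian.T a b 1)]
  · intro j a b s
    rw [LinearMap.mulLeft_apply, coeff_zero_mul', coeff_zero_shiftU, coeff_zero_serT]
    split_ifs <;> simp
  · intro j a b s
    rw [LinearMap.mulLeft_apply, coeff_one_mul', coeff_zero_shiftU, coeff_one_shiftU,
      coeff_zero_serT, coeff_serT]
    split_ifs <;> simp

/-- The lone `T_{bb}^{(1)}` next to the minor comes from the shifts, through `t a = T_{aa}^{(1)}`.
-/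
theorem coeff_two_xxxSum (K : Fin N → ℂ) {x : ℂ} (hx : ∀ a, x ≠ K a) :
    coeff 2 (xxxSum K x)
      = (∏ a, (x - K a)) • (∑ a, (-K a / (x - K a)) • (Yangian.T a a 2 : Yangian N)
        + (1 / 2 : ℂ) • ∑ a, ∑ b ∈ Finset.univ.erase a,
          (K a * K b / ((x - K a) * (x - K b))) •
          (Yangian.T a a 1 * Yangian.T b b 1 - Yangian.T a b 1 * Yangian.T b a 1
            + Yangian.T b b 1 : Yangian N)) := by
  rw [smul_add, smul_comm _ (1 / 2 : ℂ), ← sum_subsetWeight_smul_sum K hx,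
    ← sum_subsetWeight_smul_sum_pair K hx, Finset.smul_sum, ← Finset.sum_add_distrib]
  simp only [smul_comm (1 / 2 : ℂ), ← smul_add]
  rw [← sum_powersetCard_subsetWeight, xxxSum, map_sum]
  refine Finset.sum_congr rfl fun k _ => ?_
  rw [coeff_smul_complex, xxxTransfer_diagonal, coeff_two_altSum K (fun a b => Yangian.T a b 1)
    (fun a b => Yangian.T a b 1)
    (fun j a b => Yangian.T a b 2 + ((j : ℕ) : ℂ) • (Yangian.T a b 1 : Yangian N))
    (fun a => Yangian.T a a 2) (fun a => Yangian.T a a 1)]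
  · exact fun j a => rfl
  · intro j a b s
    rw [LinearMap.mulLeft_apply, coeff_zero_mul', coeff_zero_shiftU, coeff_zero_serT]
    split_ifs <;> simp
  · intro j a b s
    rw [LinearMap.mulLeft_apply, coeff_one_mul', coeff_zero_shiftU, coeff_one_shiftU,
      coeff_zero_serT, coeff_serT]
    split_ifs <;> simp
  · intro j a b s
    rw [LinearMap.mulLeft_apply, coeff_two_mul, coeff_zero_shiftU, coeff_one_shiftU,
      coeff_two_shiftU, coeff_zero_serT, coeff_serT, coeff_serT]
    split_ifs <;> simp

end XXX

/-! ### The first two Yangian coefficients on a tensor product of evaluation modules. -/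

section YangianAction

variable {N : ℕ} {A : Type*} [Ring A] [Algebra ℂ A]

theorem tensorHom_succ_T (n : ℕ) (φ : Fin (n + 1) → Yangian N →ₐ[ℂ] A)
    (hφ : ∀ i j, i ≠ j → ∀ x y, Commute (φ i x) (φ j y)) (a b : Fin N) (s : ℕ) :
    (tensorHom (n + 1) φ hφ).1 (Yangian.T a b s)
      = ∑ c, ∑ ij ∈ Finset.HasAntidiagonal.antidiagonal s, φ 0 (Yangian.T c b ij.1)
        * (tensorHom n (fun i => φ i.succ) fun i j hij => hφ i.succ j.succ
            fun h => hij (Fin.succ_injective n h)).1 (Yangian.T a c ij.2) := by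
  simp only [tensorHom, AlgHom.comp_apply, Yangian.comul, Yangian.lift_T, convFamily, map_sum,
    Algebra.TensorProduct.tmul_mul_tmul, one_mul, mul_one, Algebra.TensorProduct.lift_tmul]

theorem algHom_T_zero (φ : Yangian N →ₐ[ℂ] A) (a b : Fin N) :
    φ (Yangian.T a b 0) = if a = b then 1 else 0 :=
  ((Yangian.isYangianFamily_T N).map φ.toRingHom).zero a b

/-- `T^{(1)}` is primitive for the coproduct, because `T^{(0)}` is the identity matrix. -/
theorem tensorHom_T_one (n : ℕ) (φ : Fin n → Yangian N →ₐ[ℂ] A)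
    (hφ : ∀ i j, i ≠ j → ∀ x y, Commute (φ i x) (φ j y)) (a b : Fin N) :
    (tensorHom n φ hφ).1 (Yangian.T a b 1) = ∑ i, φ i (Yangian.T a b 1) := by
  induction n with
  | zero => simp [tensorHom, Yangian.counit, Yangian.lift_T]
  | succ n ih =>
    rw [tensorHom_succ_T, Fin.sum_univ_succ]
    simp only [Finset.Nat.sum_antidiagonal_eq_sum_range_succ_mk, Finset.sum_range_succ,
      Finset.sum_range_zero, zero_add, Nat.sub_self, Nat.sub_zero, ih,
      algHom_T_zero, Finset.sum_add_distrib, ite_mul, mul_ite, one_mul, mul_one, mul_zero, zero_mul,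
      Finset.sum_ite_eq, Finset.sum_ite_eq', Finset.mem_univ, if_true]
    rw [add_comm]

/-- `Δ T_{ab}^{(2)} = T_{ab}^{(2)} ⊗ 1 + 1 ⊗ T_{ab}^{(2)} + ∑_c T_{cb}^{(1)} ⊗ T_{ac}^{(1)}`.
Splitting off the first module gives the pairs with `i = 0`; the others come by induction. -/
theorem tensorHom_T_two (n : ℕ) (φ : Fin n → Yangian N →ₐ[ℂ] A)
    (hφ : ∀ i j, i ≠ j → ∀ x y, Commute (φ i x) (φ j y)) (a b : Fin N) :
    (tensorHom n φ hφ).1 (Yangian.T a b 2) = ∑ i, φ i (Yangian.T a b 2)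
      + ∑ c, ∑ i, ∑ j ∈ Finset.Ioi i, φ i (Yangian.T c b 1) * φ j (Yangian.T a c 1) := by
  have hIoi : ∀ {m : ℕ} (i : Fin m) (f : Fin m → A),
      ∑ j ∈ Finset.Ioi i, f j = ∑ j, if i < j then f j else 0 := by
    intro m i f
    rw [← Finset.sum_filter]
    congr 1
    ext
    simp
  simp only [hIoi]
  induction n with
  | zero => simp [tensorHom, Yangian.counit, Yangian.lift_T]
  | succ n ih =>
    rw [tensorHom_succ_T]
    simp only [Finset.Nat.sum_antidiagonal_eq_sum_range_succ_mk, Finset.sum_range_succ,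
      Finset.sum_range_zero, zero_add, Nat.sub_self, Nat.sub_zero, ih,
      tensorHom_T_one, Nat.reduceSub,
      algHom_T_zero, Finset.sum_add_distrib, ite_mul, mul_ite, one_mul, mul_one, mul_zero, zero_mul,
      Finset.sum_ite_eq, Finset.sum_ite_eq', Finset.mem_univ, if_true, Fin.sum_univ_succ,
      Fin.succ_lt_succ_iff, Fin.succ_pos, Fin.not_lt_zero, if_false,
      Finset.mul_sum]
    abel

variable {n : ℕ} (M : Fin n → Type*) [∀ i, AddCommGroup (M i)] [∀ i, Module ℂ (M i)]
  [∀ i, LieRingModule (gl N) (M i)] [∀ i, LieModule ℂ (gl N) (M i)] (z : Fin n → ℂ)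

theorem onFactor_evalAction_T_succ (i : Fin n) (a b : Fin N) (s : ℕ) :
    onFactor M i (evalAction M z i (Yangian.T a b (s + 1))) = z i ^ s • eAt M i b a := by
  simp [evalAction, Yangian.eval, Yangian.lift_T, eAt]

theorem yangianAction_T_one (a b : Fin N) :
    yangianAction M z (Yangian.T a b 1) = eTot M b a := by
  refine (tensorHom_T_one n _ _ a b).trans ?_
  rw [eTot]
  refine Finset.sum_congr rfl fun i _ => ?_
  rw [AlgHom.comp_apply, onFactor_evalAction_T_succ, pow_zero, one_smul]

theorem yangianAction_T_two (a b : Fin N) :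
    yangianAction M z (Yangian.T a b 2) = ∑ i, z i • eAt M i b a
      + ∑ c, ∑ i, ∑ j ∈ Finset.Ioi i, eAt M i b c * eAt M j c a := by
  refine (tensorHom_T_two n _ _ a b).trans ?_
  simp only [AlgHom.comp_apply, onFactor_evalAction_T_succ M z _ _ _ 0,
    onFactor_evalAction_T_succ M z _ _ _ 1, pow_zero, pow_one, one_smul]

end YangianAction

/-! ### Commutators of the total `gl_N` action. -/

section Commutators

variable {N n : ℕ} (M : Fin n → Type*) [∀ i, AddCommGroup (M i)] [∀ i, Module ℂ (M i)]
  [∀ i, LieRingModule (gl N) (M i)] [∀ i, LieModule ℂ (gl N) (M i)] (z : Fin n → ℂ)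

theorem currentRep_monomial (a b : Fin N) (s : ℕ) :
    currentRep M z (Polynomial.monomial s (e a b)) = ∑ i, z i ^ s • eAt M i a b := by
  change ∑ i, onFactor M i (LieModule.toEnd ℂ (gl N) (M i) _) = _
  refine Finset.sum_congr rfl fun i _ => ?_
  have : currentEval N (z i) (Polynomial.monomial s (e a b)) = z i ^ s • e a b := by
    change Polynomial.eval _ _ = _
    rw [Polynomial.eval_monomial, ← map_pow, ← Algebra.commutes, ← Algebra.smul_def]
  rw [this, map_smul, map_smul, eAt]

/-- Constant currents do not see the evaluation points, so `z = 0` is a convenient choice (`0 ^ 0 =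
1`); the commutators then follow from `currentRep` being a Lie homomorphism. -/
theorem eTot_eq_currentRep (a b : Fin N) :
    eTot M a b = currentRep M (0 : Fin n → ℂ) (Polynomial.monomial 0 (e a b)) := by
  rw [currentRep_monomial, eTot]
  simp

theorem eTot_commutator (a b c d : Fin N) :
    eTot M a b * eTot M c d - eTot M c d * eTot M a b
      = (if b = c then eTot M a d else 0) - (if d = a then eTot M c b else 0) := by
  have h : e a b * e c d - e c d * e a b
      = (if b = c then e a d else 0) - (if d = a then e c b else 0) := by
    by_cases h1 : b = c <;> by_cases h2 : d = a <;>
      simp [e, h1, h2, Matrix.single_mul_single_same, Matrix.single_mul_single_of_ne]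
  simp only [eTot_eq_currentRep M]
  rw [← LieRing.of_associative_ring_bracket, ← LieHom.map_lie, LieRing.of_associative_ring_bracket,
    Polynomial.monomial_mul_monomial, Polynomial.monomial_mul_monomial, ← map_sub, add_zero, h,
    map_sub, map_sub]
  split_ifs <;> simp

end Commutators

/-! ### Substituting a number for `∂` in a formal differential operator. -/

section DiffOpEval

open Polynomial

variable {B : Type*} [Ring B] [Algebra ℂ B]

/-- The symbol form of `e^{-xu} ∂ e^{xu} = x + ∂`. Linearity of `δ` over `ℂ` lets it pass through
the powers of `x`. -/
theorem eval_derMul (δ : B →ₗ[ℂ] B) (x : ℂ) (P : B[X]) :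
    (derMul δ P).eval (algebraMap ℂ B x)
      = x • P.eval (algebraMap ℂ B x) + δ (P.eval (algebraMap ℂ B x)) := by
  have hm : ∀ (b : B) (i : ℕ), b * algebraMap ℂ B x ^ i = x ^ i • b := by
    intro b i
    rw [← map_pow, ← Algebra.commutes, ← Algebra.smul_def]
  rw [derMul, Polynomial.sum_def, eval_finsetSum, eval_eq_sum, Polynomial.sum_def, map_sum,
    Finset.smul_sum, ← Finset.sum_add_distrib]
  refine Finset.sum_congr rfl fun i _ => ?_
  rw [eval_add, eval_monomial, eval_monomial, hm, hm, hm, map_smul, pow_succ', mul_smul]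

theorem natDegree_derMul_le (δ : B →ₗ[ℂ] B) (P : B[X]) :
    (derMul δ P).natDegree ≤ P.natDegree + 1 := by
  refine natDegree_sum_le_of_forall_le _ _ fun i hi => ?_
  have hi' := le_natDegree_of_mem_supp i hi
  refine (natDegree_add_le _ _).trans (max_le ?_ ?_)
  · exact (natDegree_monomial_le _).trans (by omega)
  · exact (natDegree_monomial_le _).trans (by omega)

theorem diffOpMul_X_sub_C (δ : B →ₗ[ℂ] B) (a b : B) (Q : B[X]) :
    diffOpMul δ (X - C a - C b) Q = derMul δ Q - C (a + b) * Q := by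
  have h : (X - C a - C b : B[X]).natDegree < 2 := by
    rw [sub_sub, ← C_add]
    exact (natDegree_X_sub_C_le _).trans_lt one_lt_two
  rw [diffOpMul, sum_over_range' _ (fun n => by simp) 2 h]
  simp [Finset.sum_range_succ, coeff_X, coeff_C, add_mul, sub_eq_add_neg]
  abel

theorem eval_diffOpMul_X_sub_C (δ : B →ₗ[ℂ] B) (x : ℂ) (a b : B) (Q : B[X]) :
    (diffOpMul δ (X - C a - C b) Q).eval (algebraMap ℂ B x)
      = (algebraMap ℂ B x - a - b) * Q.eval (algebraMap ℂ B x)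
        + δ (Q.eval (algebraMap ℂ B x)) := by
  rw [diffOpMul_X_sub_C, eval_sub, eval_derMul, eval_C_mul, sub_sub, sub_mul, ← Algebra.smul_def]
  abel

theorem natDegree_diffOpMul_X_sub_C_le (δ : B →ₗ[ℂ] B) (a b : B) (Q : B[X]) :
    (diffOpMul δ (X - C a - C b) Q).natDegree ≤ Q.natDegree + 1 := by
  rw [diffOpMul_X_sub_C]
  refine (natDegree_sub_le _ _).trans (max_le (natDegree_derMul_le δ Q) ?_)
  exact (natDegree_C_mul_le _ _).trans (Nat.le_succ _)

end DiffOpEval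

/-! ### The derivative `d/du` as a linear map. -/

section DerivU

open PowerSeries

variable {R : Type*} [Ring R] [Algebra ℂ R]

theorem coeff_zero_derivU {R : Type*} [Ring R] (f : PowerSeries R) : coeff 0 (derivU f) = 0 := by
  simp [derivU]

theorem coeff_one_derivU {R : Type*} [Ring R] (f : PowerSeries R) : coeff 1 (derivU f) = 0 := by
  simp [derivU]

theorem coeff_two_derivU {R : Type*} [Ring R] (f : PowerSeries R) : coeff 2 (derivU f) = -coeff 1 f := by
  simp [derivU]

variable (R) in
/-- `d/du` as a linear map. -/
noncomputable def derivULin : Module.End ℂ (PowerSeries R) where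
  toFun := derivU
  map_add' f g := by
    ext m
    rcases m with _ | m
    · simp [derivU]
    · simp [derivU]
      abel
  map_smul' c f := by
    ext m
    rcases m with _ | m
    · simp [derivU]
    · simp only [derivU, coeff_mk, coeff_smul_complex, RingHom.id_apply, smul_neg]
      rw [smul_comm]

theorem derivULin_apply (f : PowerSeries R) : derivULin R f = derivU f := rfl

end DerivU

/-! ### The Gaudin generating sum in `U(gl_N[x])`. -/

section Gaudin

open PowerSeries

variable {N : ℕ}

/-- The operator `δ_{ab} (x - K_a + d/du) - L_{ab}(u)` on series. -/
noncomputable def gaudinStep (K : Fin N → ℂ) (x : ℂ) (a b : Fin N) :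
    Module.End ℂ (PowerSeries (UniversalEnvelopingAlgebra ℂ (current N))) :=
  (if a = b then (x - K a) • 1 + derivULin _ else 0) - LinearMap.mulLeft ℂ (serL N a b)

theorem legAct_gaudinStep {k : ℕ} (K : Fin N → ℂ) (x : ℂ) (l : Fin k)
    (Z : Matrix (Fin k → Fin N) (Fin k → Fin N)
      (PowerSeries (UniversalEnvelopingAlgebra ℂ (current N)))) :
    legAct l (gaudinStep K x) Z
      = (algebraMap ℂ _ x - leg l (scalarMat (Matrix.diagonal K)) - leg l (serL N)) * Z
        + Z.map derivU := by
  rw [sub_mul, sub_mul, leg_mul, leg_mul, ← Algebra.smul_def]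
  ext1 p q
  simp only [legAct, gaudinStep, Matrix.of_apply, Matrix.add_apply, Matrix.sub_apply,
    LinearMap.sub_apply, Finset.sum_sub_distrib, LinearMap.mulLeft_apply, scalarMat,
    Matrix.map_apply, Matrix.smul_apply]
  have hd : ∑ b, Matrix.diagonal K (p l) b • Z (Function.update p l b) q = K (p l) • Z p q := by
    simp [Matrix.diagonal_apply]
  rw [Finset.sum_eq_single (p l)]
  · simp only [if_true, Function.update_eq_self, LinearMap.add_apply,
      LinearMap.smul_apply, Module.End.one_apply, derivULin_apply, ← Algebra.smul_def, sub_smul, hd]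
    abel
  · intro b _ hb
    rw [if_neg hb.symm, LinearMap.zero_apply]
  · simp

/-- `∑_k x^{N-k} (-1)ᵏ 𝒢_{k,K}(u)`. -/
noncomputable def gaudinSum (K : Fin N → ℂ) (x : ℂ) :
    PowerSeries (UniversalEnvelopingAlgebra ℂ (current N)) :=
  ∑ k ∈ Finset.range (N + 1), ((-1) ^ k * x ^ (N - k)) • gaudinTransfer k (Matrix.diagonal K)

/-- The entrywise derivative `d/du` of matrices of series. -/
noncomputable def derivUMat (I R : Type*) [Ring R] [Algebra ℂ R] :
    Matrix I I (PowerSeries R) →ₗ[ℂ] Matrix I I (PowerSeries R) :=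
  (derivULin R).mapMatrix

/-- The generating sum contains only the coefficients of `∂⁰, …, ∂ᴺ`; the degree bound makes it
equal to the full evaluation at `x`. -/
theorem natDegree_gaudinDiffOpMat_le (K : Fin N → ℂ) :
    (gaudinDiffOpMat (Matrix.diagonal K)).natDegree ≤ N := by
  have key : ∀ ls : List (Fin N), ((ls.map fun i => Polynomial.X
      - Polynomial.C (leg i (scalarMat (Matrix.diagonal K))) - Polynomial.C (leg i (serL N))).foldr
      (diffOpMul (derivUMat (Fin N → Fin N) _)) (Polynomial.C (scalarMat (antisym N N)))).natDegree
      ≤ ls.length := by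
    intro ls
    induction ls with
    | nil => simp
    | cons i ls ih =>
      rw [List.map_cons, List.foldr_cons, List.length_cons]
      exact (natDegree_diffOpMul_X_sub_C_le _ _ _ _).trans (Nat.succ_le_succ ih)
  have := key (List.finRange N)
  rw [List.length_finRange] at this
  rw [gaudinDiffOpMat, List.ofFn_eq_map]
  exact this

theorem eval_gaudinDiffOpMat (K : Fin N → ℂ) (x : ℂ) :
    (gaudinDiffOpMat (Matrix.diagonal K)).eval (algebraMap ℂ _ x)
      = (List.finRange N).foldr (fun j => legAct j (gaudinStep K x)) (scalarMat (antisym N N)) := by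
  have key : ∀ ls : List (Fin N), ((ls.map fun i => Polynomial.X
      - Polynomial.C (leg i (scalarMat (Matrix.diagonal K))) - Polynomial.C (leg i (serL N))).foldr
      (diffOpMul (derivUMat (Fin N → Fin N) _)) (Polynomial.C (scalarMat (antisym N N)))).eval
        (algebraMap ℂ _ x)
      = ls.foldr (fun j => legAct j (gaudinStep K x)) (scalarMat (antisym N N)) := by
    intro ls
    induction ls with
    | nil => simp
    | cons i ls ih =>
      rw [List.map_cons, List.foldr_cons, List.foldr_cons, eval_diffOpMul_X_sub_C, ih,
        legAct_gaudinStep]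
      rfl
  rw [gaudinDiffOpMat, List.ofFn_eq_map]
  exact key (List.finRange N)

theorem gaudinSum_eq_trace_eval (K : Fin N → ℂ) (x : ℂ) :
    gaudinSum K x
      = Matrix.trace ((gaudinDiffOpMat (Matrix.diagonal K)).eval (algebraMap ℂ _ x)) := by
  rw [Polynomial.eval_eq_sum_range' (Nat.lt_succ_of_le (natDegree_gaudinDiffOpMat_le K)),
    Matrix.trace_sum, gaudinSum, ← Finset.sum_range_reflect]
  refine Finset.sum_congr rfl fun k hk => ?_
  have hk' : N - (N + 1 - 1 - k) = k := by
    have := Finset.mem_range.1 hk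
    omega
  rw [gaudinTransfer, hk', ← map_pow, ← Algebra.commutes, ← Algebra.smul_def, Matrix.trace_smul,
    mul_comm, mul_smul]
  congr 1
  -- The sign in the definition of the transfer matrix cancels the one in the generating sum.
  rw [← smul_mul_assoc, Algebra.smul_def, map_pow, map_neg, map_one, ← pow_add, Even.neg_one_pow ⟨_, rfl⟩, one_mul]

theorem prod_ofFn_smul {S : Type*} [AddCommGroup S] [Module ℂ S] {k : ℕ} (c : Fin k → ℂ)
    (G : Fin k → Module.End ℂ S) :
    (List.ofFn fun j => c j • G j).prod = (∏ j, c j) • (List.ofFn G).prod := by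
  induction k with
  | zero => simp
  | succ k ih =>
    rw [List.ofFn_succ, List.prod_cons, ih, List.ofFn_succ, List.prod_cons, Fin.prod_univ_succ,
      smul_mul_smul_comm]

/-- Dividing the entries in row `a` by `x - K_a` makes their leading term `δ_{ab}`; the weight `∏ (x
- K_{p l})` restores what was divided out. -/
theorem gaudinSum_eq_altSum (K : Fin N → ℂ) {x : ℂ} (hx : ∀ a, x ≠ K a) :
    gaudinSum K x = altSum (fun a => x - K a) fun (_ : Fin N) a b =>
      (x - K a)⁻¹ • gaudinStep K x a b := by
  rw [gaudinSum_eq_trace_eval, eval_gaudinDiffOpMat, altSum]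
  have h := sum_foldr_legAct_antisym (Equiv.refl (Fin N)) (fun _ => gaudinStep K x)
    (1 : PowerSeries (UniversalEnvelopingAlgebra ℂ (current N))) fun _ => 1
  have hA : Matrix.of (fun r q => antisym N N r q •
      (1 : PowerSeries (UniversalEnvelopingAlgebra ℂ (current N)))) = scalarMat (antisym N N) := by
    ext1 r q
    simp [scalarMat, Algebra.algebraMap_eq_smul_one]
  rw [hA] at h
  simp only [Finset.prod_const_one, one_smul, Equiv.refl_apply] at h
  refine Eq.trans (by rfl) (h.trans ?_)
  congr 1
  refine Finset.sum_congr rfl fun p _ => ?_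
  rw [Finset.smul_sum]
  refine Finset.sum_congr rfl fun σ _ => ?_
  rw [smul_comm, prod_ofFn_smul, LinearMap.smul_apply, smul_smul (∏ l, _), ← Finset.prod_mul_distrib,
    Finset.prod_congr rfl (fun l _ => mul_inv_cancel₀ (sub_ne_zero.2 (hx (p l)))),
    Finset.prod_const_one, one_smul]

/-- The element `e_{ab} xˢ` of `U(gl_N[x])`. -/
noncomputable def curGen (a b : Fin N) (s : ℕ) : UniversalEnvelopingAlgebra ℂ (current N) :=
  UniversalEnvelopingAlgebra.ι ℂ (Polynomial.monomial s (e a b) : current N)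

theorem coeff_gaudinStep (K : Fin N → ℂ) {x : ℂ} (hx : ∀ a, x ≠ K a) (a b : Fin N) (m : ℕ)
    (s : PowerSeries (UniversalEnvelopingAlgebra ℂ (current N))) :
    coeff m (((x - K a)⁻¹ • gaudinStep K x a b) s)
      = (if a = b then (1 : ℂ) else 0) • coeff m s
        + (x - K a)⁻¹ • ((if a = b then (1 : ℂ) else 0) • coeff m (derivU s)
          - coeff m (serL N a b * s)) := by
  have := sub_ne_zero.2 (hx a)
  rw [LinearMap.smul_apply, coeff_smul_complex, gaudinStep, LinearMap.sub_apply, map_sub,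
    LinearMap.mulLeft_apply]
  split_ifs
  · simp only [LinearMap.add_apply, LinearMap.smul_apply, Module.End.one_apply, derivULin_apply,
      map_add, coeff_smul_complex, one_smul, smul_sub, smul_add, inv_smul_smul₀ this]
    abel
  · simp

theorem coeff_zero_serL (a b : Fin N) : coeff 0 (serL N a b) = 0 := by
  simp [serL]

theorem coeff_succ_serL (a b : Fin N) (s : ℕ) : coeff (s + 1) (serL N a b) = curGen b a s := by
  simp [serL, curGen]

theorem coeff_zero_gaudinStep (K : Fin N → ℂ) {x : ℂ} (hx : ∀ a, x ≠ K a) (a b : Fin N)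
    (s : PowerSeries (UniversalEnvelopingAlgebra ℂ (current N))) :
    coeff 0 (((x - K a)⁻¹ • gaudinStep K x a b) s)
      = (if a = b then (1 : ℂ) else 0) • coeff 0 s := by
  rw [coeff_gaudinStep K hx, coeff_zero_mul', coeff_zero_serL, coeff_zero_derivU]
  simp

theorem coeff_one_gaudinStep (K : Fin N → ℂ) {x : ℂ} (hx : ∀ a, x ≠ K a) (a b : Fin N)
    (s : PowerSeries (UniversalEnvelopingAlgebra ℂ (current N))) :
    coeff 1 (((x - K a)⁻¹ • gaudinStep K x a b) s)
      = (if a = b then (1 : ℂ) else 0) • coeff 1 s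
        + (-(x - K a)⁻¹ • curGen b a 0) * coeff 0 s := by
  rw [coeff_gaudinStep K hx, coeff_one_mul', coeff_zero_serL, coeff_one_derivU,
    coeff_succ_serL a b 0]
  simp

/-- The `δ_{ab}` added to `e_{ba}` is the effect of `d/du`, whose `u⁻²` coefficient is minus the
`u⁻¹` coefficient of its argument. -/
theorem coeff_two_gaudinStep (K : Fin N → ℂ) {x : ℂ} (hx : ∀ a, x ≠ K a) (a b : Fin N)
    (s : PowerSeries (UniversalEnvelopingAlgebra ℂ (current N))) :
    coeff 2 (((x - K a)⁻¹ • gaudinStep K x a b) s)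
      = (if a = b then (1 : ℂ) else 0) • coeff 2 s
        + (-(x - K a)⁻¹ • (curGen b a 0 + if a = b then 1 else 0)) * coeff 1 s
        + (-(x - K a)⁻¹ • curGen b a 1) * coeff 0 s := by
  rw [coeff_gaudinStep K hx, coeff_two_mul, coeff_zero_serL, coeff_two_derivU,
    coeff_succ_serL a b 0, coeff_succ_serL a b 1, smul_mul_assoc, smul_mul_assoc, add_mul]
  split_ifs
  · simp only [one_smul, one_mul, zero_mul]
    module
  · simp only [zero_smul, zero_mul]
    module

theorem coeff_zero_gaudinSum (K : Fin N → ℂ) {x : ℂ} (hx : ∀ a, x ≠ K a) :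
    coeff 0 (gaudinSum K x) = (∏ a, (x - K a)) • 1 := by
  rw [gaudinSum_eq_altSum K hx, coeff_zero_altSum _ _ fun _ => coeff_zero_gaudinStep K hx]
  -- Here `k = N`, so the full index set is the only subset.
  have : Finset.powersetCard N (Finset.univ : Finset (Fin N)) = {Finset.univ} := by
    simpa using Finset.powersetCard_self (Finset.univ : Finset (Fin N))
  rw [this, Finset.sum_singleton]

theorem coeff_one_gaudinSum (K : Fin N → ℂ) {x : ℂ} (hx : ∀ a, x ≠ K a) :
    coeff 1 (gaudinSum K x)
      = (∏ a, (x - K a)) • ∑ a, (-(x - K a)⁻¹) • curGen a a 0 := by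
  rw [gaudinSum_eq_altSum K hx, coeff_one_altSum _ _ _ (fun _ => coeff_zero_gaudinStep K hx)
    (fun _ => coeff_one_gaudinStep K hx)]
  have : Finset.powersetCard N (Finset.univ : Finset (Fin N)) = {Finset.univ} := by
    simpa using Finset.powersetCard_self (Finset.univ : Finset (Fin N))
  rw [this, Finset.sum_singleton]

/-- There is no positional shift, so `t = 0`; the lone `e_{bb}` is the product of the unit in `P' a
a` with `P b b`. -/
theorem coeff_two_gaudinSum (K : Fin N → ℂ) {x : ℂ} (hx : ∀ a, x ≠ K a) :
    coeff 2 (gaudinSum K x)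
      = (∏ a, (x - K a)) • (∑ a, (-(x - K a)⁻¹) • curGen a a 1
        + (1 / 2 : ℂ) • ∑ a, ∑ b ∈ Finset.univ.erase a, (1 / ((x - K a) * (x - K b))) •
          (curGen a a 0 * curGen b b 0 - curGen b a 0 * curGen a b 0 + curGen b b 0)) := by
  rw [gaudinSum_eq_altSum K hx, coeff_two_altSum _ _ _ (fun _ a b => -(x - K a)⁻¹ • curGen b a 1)
    (fun a => -(x - K a)⁻¹ • curGen a a 1) 0 _ (fun j a => by simp)
    (fun _ => coeff_zero_gaudinStep K hx)
    (fun _ => coeff_one_gaudinStep K hx) (fun _ => coeff_two_gaudinStep K hx)]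
  have : Finset.powersetCard N (Finset.univ : Finset (Fin N)) = {Finset.univ} := by
    simpa using Finset.powersetCard_self (Finset.univ : Finset (Fin N))
  rw [this, Finset.sum_singleton]
  congr 3
  refine Finset.sum_congr rfl fun a _ => Finset.sum_congr rfl fun b hb => ?_
  rw [if_pos rfl, if_neg (Finset.ne_of_mem_erase hb).symm, smul_mul_smul_comm, smul_mul_smul_comm,
    neg_mul_neg, ← smul_sub, one_div, mul_inv, add_mul, one_mul, add_zero, Pi.zero_apply, add_zero]
  congr 1
  abel

end Gaudin

/-! ### Passage to operators on the tensor product, and assembly. -/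

open PowerSeries

variable {N n : ℕ} (M : Fin n → Type*) [∀ i, AddCommGroup (M i)] [∀ i, Module ℂ (M i)]
  [∀ i, LieRingModule (gl N) (M i)] [∀ i, LieModule ℂ (gl N) (M i)]

theorem neg_smul_end {n : ℕ} {M : Fin n → Type*} [∀ i, AddCommGroup (M i)]
    [∀ i, Module ℂ (M i)] (c : ℂ) (T : Module.End ℂ (⨂[ℂ] j, M j)) : (-c) • T = -(c • T) :=
  neg_smul c T

theorem currentAction_curGen (z : Fin n → ℂ) (a b : Fin N) (s : ℕ) :
    currentAction M z (curGen a b s) = ∑ i, z i ^ s • eAt M i a b := by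
  rw [currentAction, curGen, UniversalEnvelopingAlgebra.lift_ι_apply, currentRep_monomial]

theorem currentAction_curGen_zero (z : Fin n → ℂ) (a b : Fin N) :
    currentAction M z (curGen a b 0) = eTot M a b := by
  simp [currentAction_curGen, eTot]

theorem coeff_gaudinGen (K : Fin N → ℂ) (z : Fin n → ℂ) (x : ℂ) (m : ℕ) :
    coeff m (gaudinGen M K z x)
      = (∏ a, (x - K a))⁻¹ • currentAction M z (coeff m (gaudinSum K x)) := by
  simp only [gaudinGen, gaudinSum, map_sum, Finset.smul_sum, coeff_smul_complex, gaudinOp]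
  refine Finset.sum_congr rfl fun k _ => ?_
  rw [coeff_map, map_smul, smul_smul]
  congr 1
  simp only [one_div, Finset.prod_inv_distrib]
  ring

theorem coeff_xxxGen (K : Fin N → ℂ) (z : Fin n → ℂ) (x : ℂ) (m : ℕ) :
    coeff m (xxxGen M K z x)
      = (∏ a, (x - K a))⁻¹ • yangianAction M z (coeff m (xxxSum K x)) := by
  simp only [xxxGen, xxxSum, map_sum, Finset.smul_sum, coeff_smul_complex, xxxOp]
  refine Finset.sum_congr rfl fun k _ => ?_
  rw [coeff_map, map_smul, smul_smul]
  congr 1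
  simp only [one_div, Finset.prod_inv_distrib]
  ring

theorem exists_X_pow_three_mul {R : Type*} [Ring R] (f : PowerSeries R) (A B : R)
    (h0 : coeff 0 f = 1) (h1 : coeff 1 f = -A) (h2 : coeff 2 f = -B) :
    ∃ r : PowerSeries R, f = 1 - X * C A - X ^ 2 * C B + X ^ 3 * r := by
  refine ⟨mk fun m => coeff (m + 3) f, ?_⟩
  ext m
  rcases m with _ | _ | _ | m
  · simp [h0, pow_succ', mul_assoc]
  · simp [h1, pow_succ', mul_assoc, coeff_one, coeff_succ_X_mul]
  · simp only [pow_succ', mul_assoc, map_add, map_sub, coeff_succ_X_mul, pow_zero, one_mul]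
    simp [h2, coeff_one]
  · simp only [pow_succ', mul_assoc, map_add, map_sub, coeff_succ_X_mul, pow_zero, one_mul]
    simp [coeff_one]

/-- The operator `e_{ab} e_{ba} - e_{aa} - e_{aa} e_{bb}`. -/
noncomputable def pairOp (a b : Fin N) : Module.End ℂ (⨂[ℂ] j, M j) :=
  eTot M a b * eTot M b a - eTot M a a - eTot M a a * eTot M b b

/-- This is `[e_{ab}, e_{ba}] = e_{aa} - e_{bb}`. -/
theorem pairOp_eq {a b : Fin N} :
    eTot M a a * eTot M b b - eTot M b a * eTot M a b + eTot M b b = -pairOp M a b := by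
  have h := eTot_commutator M a b b a
  simp only [if_true] at h
  rw [pairOp, eq_neg_iff_add_eq_zero]
  have h' := sub_eq_zero.2 h
  rw [← h']
  abel

/-- Since `e_{aa}` and `e_{bb}` commute, `pairOp_eq` expresses the operator by the formula with `a`
and `b` exchanged. -/
theorem pairOp_symm (a b : Fin N) : pairOp M a b = pairOp M b a := by
  have h : eTot M a a * eTot M b b = eTot M b b * eTot M a a := by
    have := eTot_commutator M a a b b
    rw [← sub_eq_zero, this]
    by_cases hab : a = b
    · subst hab
      simp
    · simp [hab, Ne.symm hab]
  have h2 := pairOp_eq M (a := a) (b := b)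
  rw [← neg_inj, ← h2, pairOp, h]
  abel

/-- Common final step of both models: `u` is constantly 1 for Gaudin and is `K` for XXX, and `Z` is
the action of the one-index second-order term. -/
theorem neg_sum_smul_pair_eq {K : Fin N → ℂ} (hK : Function.Injective K) {x : ℂ}
    (hx : ∀ a, x ≠ K a) (u : Fin N → ℂ) (Z : Fin N → Module.End ℂ (⨂[ℂ] j, M j)) :
    ∑ a, (-u a / (x - K a)) • Z a
        + (1 / 2 : ℂ) • ∑ a, ∑ b ∈ Finset.univ.erase a, (u a * u b / ((x - K a) * (x - K b))) •
          (eTot M a a * eTot M b b - eTot M b a * eTot M a b + eTot M b b)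
      = -∑ a, (u a / (x - K a)) •
          (Z a + ∑ b ∈ Finset.univ.erase a, (u b / (K a - K b)) • pairOp M a b) := by
  have h := sum_pair_partial_fractions hK hx (fun a b => u a * u b) (fun a b => mul_comm _ _)
    (pairOp M) (pairOp_symm M)
  simp only [pairOp_eq, smul_neg, Finset.sum_neg_distrib]
  rw [← h]
  rw [← Finset.sum_neg_distrib, ← Finset.sum_neg_distrib, ← Finset.sum_add_distrib]
  refine Finset.sum_congr rfl fun a _ => ?_
  rw [neg_div, neg_smul_end, ← neg_add, smul_add, Finset.smul_sum]
  congr 2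
  refine Finset.sum_congr rfl fun b _ => ?_
  rw [smul_smul]
  congr 1
  ring

end DynHam

theorem propositionB1 {N n : ℕ} (M : Fin n → Type*)
    [∀ i, AddCommGroup (M i)] [∀ i, Module ℂ (M i)]
    [∀ i, LieRingModule (gl N) (M i)] [∀ i, LieModule ℂ (gl N) (M i)]
    (K : Fin N → ℂ) (hK : Function.Injective K) (z : Fin n → ℂ) (x : ℂ) (hx : ∀ a, x ≠ K a) :
    (∃ R : PowerSeries (Module.End ℂ (⨂[ℂ] j, M j)),
      gaudinGen M K z x =
        1 - PowerSeries.X * PowerSeries.C (∑ a, (1 / (x - K a)) • eTot M a a)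
          - PowerSeries.X ^ 2 * PowerSeries.C (∑ a, (1 / (x - K a)) •
              (ratHam M K z a - ∑ b ∈ Finset.univ.erase a,
                (1 / (K a - K b)) • (eTot M a a * eTot M b b)))
          + PowerSeries.X ^ 3 * R) ∧
    (∃ R : PowerSeries (Module.End ℂ (⨂[ℂ] j, M j)),
      xxxGen M K z x =
        1 - PowerSeries.X * PowerSeries.C (∑ a, (K a / (x - K a)) • eTot M a a)
          - PowerSeries.X ^ 2 * PowerSeries.C (∑ a, (K a / (x - K a)) •
              (trigHam M K z a + (1 / 2 : ℂ) • (eTot M a a) ^ 2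
                - ∑ b ∈ Finset.univ.erase a,
                  (K b / (K a - K b)) • (eTot M a a * eTot M b b)))
          + PowerSeries.X ^ 3 * R) := by
  have hp : ∏ a, (x - K a) ≠ 0 := Finset.prod_ne_zero_iff.2 fun a _ => sub_ne_zero.2 (hx a)
  constructor
  · apply exists_X_pow_three_mul
    · rw [coeff_gaudinGen, coeff_zero_gaudinSum K hx, map_smul, inv_smul_smul₀ hp, map_one]
    · rw [coeff_gaudinGen, coeff_one_gaudinSum K hx, map_smul, inv_smul_smul₀ hp, map_sum]
      simp only [map_smul, currentAction_curGen_zero]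
      simp only [neg_smul_end, Finset.sum_neg_distrib, one_div]
    · rw [coeff_gaudinGen, coeff_two_gaudinSum K hx, map_smul, inv_smul_smul₀ hp]
      have h := neg_sum_smul_pair_eq M hK hx (fun _ => 1) fun a => ∑ i, z i • eAt M i a a
      simp only [mul_one, neg_div, one_div] at h
      simp only [map_add, map_sub, map_mul, map_smul, map_sum, currentAction_curGen_zero,
        currentAction_curGen M z _ _ 1, pow_one, one_div]
      rw [h]
      congr 1
      refine Finset.sum_congr rfl fun a _ => ?_
      congr 1
      rw [ratHam, add_sub_assoc, ← Finset.sum_sub_distrib]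
      simp only [smul_sub, pairOp, one_div]
  · apply exists_X_pow_three_mul
    · rw [coeff_xxxGen, coeff_zero_xxxSum K hx, map_smul, inv_smul_smul₀ hp, map_one]
    · rw [coeff_xxxGen, coeff_one_xxxSum K hx, map_smul, inv_smul_smul₀ hp, map_sum]
      simp only [map_smul, yangianAction_T_one]
      simp only [neg_div, neg_smul_end, Finset.sum_neg_distrib]
    · rw [coeff_xxxGen, coeff_two_xxxSum K hx, map_smul, inv_smul_smul₀ hp]
      have h := neg_sum_smul_pair_eq M hK hx K fun a => ∑ i, z i • eAt M i a a
        + ∑ b, ∑ i, ∑ j ∈ Finset.Ioi i, eAt M i a b * eAt M j b a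
      simp only [map_add, map_sub, map_mul, map_smul, map_sum, yangianAction_T_one,
        yangianAction_T_two]
      rw [h]
      congr 1
      refine Finset.sum_congr rfl fun a _ => ?_
      congr 1
      -- The added `e_{aa}² / 2` cancels the `-e_{aa}² / 2` built into the trigonometric
      -- Hamiltonian.
      simp only [trigHam, pairOp, smul_sub, Finset.sum_sub_distrib]
      abel
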